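/- Let $p,q\ge 1$ be integers, let $\mathbf A=(A_1,\dots,A_p)$ and $\mathbf B=(B_1,\dots,B_q)$ be vectors with positive entries, and assume $$\Delta=\sum_{j=1}^q B_j-\sum_{k=1}^p A_k=0 .$$ Put $\rho=\prod_{k=1}^p A_k^{A_k}\prod_{j=1}^q B_j^{-B_j}$. For $\mathbf a\in\mathbb R^p$, $\mathbf b\in\mathbb R^q$ put $$\mu=\mu(\mathbf a,\mathbf b)=\sum_{j=1}^q b_j-\sum_{k=1}^p a_k+\frac{p-q}{2},$$ and for $0<x<\rho$ let $$H(x\,|\,\mathbf a,\mathbf b)=\frac{1}{2\pi i}\int_{\mathcal L}\frac{\prod_{k=1}^p\Gamma(A_ks+a_k)}{\prod_{j=1}^q\Gamma(B_js+b_j)}\,x^{-s}\,ds$$ be the delta neutral Fox function $H^{p,0}_{q,p}$, where $\mathcal L$ is a left loop, lying in a horizontal strip, that starts at $-\infty+i\varphi_1$, ends at $-\infty+i\varphi_2$ ($\varphi_1<0<\varphi_2$) and leaves all the poles of the integrand on its left. Let $S=\{(\mathbf a,\mathbf b)\in\mathbb R^{p+q}:\ a_k\ge 0 \text{ for all } k,\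 \mu(\mathbf a,\mathbf b)>0\}$, and let $(\mathbf a^*,\mathbf b^*)\in\mathbb R^{p+q}$ satisfy $a_k^*\ge 0$ for all $k$ and $\mu(\mathbf a^*,\mathbf b^*)=0$ (so that it is a limit point of $S$). Put $$\nu^*=(2\pi)^{(p-q)/2}\prod_{k=1}^p A_k^{a_k^*-1/2}\prod_{j=1}^q B_j^{1/2-b_j^*}.$$ Then $H(\cdot\,|\,\mathbf a,\mathbf b)$, for every $(\mathbf a,\mathbf b)\in S$, and $H(\cdot\,|\,\mathbf a^*,\mathbf b^*)$ are integrable on $[0,\rho]$, and for every $0\le\eta<\rho$ the signed measures $H(x\,|\,\mathbf a,\mathbf b)\,dx$ converge weakly on $[\eta,\rho]$ to the signed measure $$\nu^*\rho\,\delta_\rho+H(x\,|\,\mathbf a^*,\mathbf b^*)\,dx$$ as $S\ni(\mathbf a,\mathbf b)\to(\mathbf a^*,\mathbf b^*)$; that is, the integrals over $[\eta,\rho]$ of every function continuous on $[\eta,\rho]$ converge. In particular, for every $f$ continuous on $[\eta,\rho]$, $$\int_\eta^\rho f(x)H(x\,|\,\mathbf a^*,\mathbf b^*)\,dx=\lim_{S\ni(\mathbf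 a,\mathbf b)\to(\mathbf a^*,\mathbf b^*)}\int_\eta^\rho f(x)H(x\,|\,\mathbf a,\mathbf b)\,dx-\nu^*\rho f(\rho).$$ -/

import Mathlib

noncomputable section

namespace FoxH

variable {p q : ℕ}

/-- The gamma ratio `∏ₖ Γ(Aₖ s + aₖ) / ∏ⱼ Γ(Bⱼ s + bⱼ)`. Since `Complex.Gamma` and division take the
value `0` at a pole and at a zero divisor, the factor `1 / Γ` has its correct value `0` at the poles
of `Γ`. -/
def gammaRatio (A a : Fin p → ℝ) (B b : Fin q → ℝ) (s : ℂ) : ℂ :=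
  (∏ k, Complex.Gamma (A k * s + a k)) / ∏ j, Complex.Gamma (B j * s + b j)

/-- The Mellin-Barnes integrand `∏ₖ Γ(Aₖ s + aₖ) / ∏ⱼ Γ(Bⱼ s + bⱼ) * x ^ (-s)`. -/
def integrand (A a : Fin p → ℝ) (B b : Fin q → ℝ) (x : ℝ) (s : ℂ) : ℂ :=
  gammaRatio A a B b s * (x : ℂ) ^ (-s)

/-- The integral of `F` along the left loop `-∞ + i φ₁ → c + i φ₁ → c + i φ₂ → -∞ + i φ₂`. -/
def leftLoopIntegral (F : ℂ → ℂ) (φ₁ φ₂ c : ℝ) : ℂ :=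
  (∫ u in Set.Iic c, F (u + φ₁ * Complex.I))
    + Complex.I * (∫ t in φ₁..φ₂, F (c + t * Complex.I))
    - ∫ u in Set.Iic c, F (u + φ₂ * Complex.I)

/-- A real abscissa to the right of all the points `-aₖ / Aₖ`, hence of all the poles
`-(aₖ + n) / Aₖ` of the gamma ratio, which are real. -/
def abscissa (A a : Fin p → ℝ) : ℝ := 1 + ∑ k, |a k| / A k

/-- Complex value of the delta neutral `H^{p,0}_{q,p}(x | (B, b); (A, a))` for `0 < x < ρ`: the
integral of the Mellin-Barnes integrand over a left loop that encloses all its poles,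
divided by `2πi`. (The value does not depend on the choice of the loop.) -/
def foxHComplex (A a : Fin p → ℝ) (B b : Fin q → ℝ) (x : ℝ) : ℂ :=
  (2 * Real.pi * Complex.I)⁻¹ *
    leftLoopIntegral (integrand A a B b x) (-1) 1 (abscissa A a)

/-- The delta neutral Fox function `H^{p,0}_{q,p}(x | (B, b); (A, a))` for `0 < x < ρ`, as a real
number; see `foxHComplex_eq_ofReal`. -/
def foxH (A a : Fin p → ℝ) (B b : Fin q → ℝ) (x : ℝ) : ℝ :=
  (foxHComplex A a B b x).re

lemma integrand_conj (A a : Fin p → ℝ) (B b : Fin q → ℝ) {x : ℝ} (hx : 0 < x) (s : ℂ) :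
    integrand A a B b x (starRingEnd ℂ s) = starRingEnd ℂ (integrand A a B b x s) := by
  have h1 : ∀ (α β : ℝ), Complex.Gamma (α * starRingEnd ℂ s + β)
      = starRingEnd ℂ (Complex.Gamma (α * s + β)) := by
    intro α β
    rw [← Complex.Gamma_conj]
    simp
  have h2 : (x : ℂ) ^ (-(starRingEnd ℂ s)) = starRingEnd ℂ ((x : ℂ) ^ (-s)) := by
    rw [← map_neg, Complex.cpow_conj, Complex.conj_ofReal]
    rw [Complex.arg_ofReal_of_nonneg hx.le]
    exact Real.pi_ne_zero.symm
  simp only [integrand, gammaRatio, map_mul, map_div₀, map_prod, h1, h2]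

/-- The contour integral is real, so that passing to `foxH` loses nothing. -/
theorem foxHComplex_eq_ofReal (A a : Fin p → ℝ) (B b : Fin q → ℝ) {x : ℝ} (hx : 0 < x) :
    foxHComplex A a B b x = (foxH A a B b x : ℂ) := by
  refine (Complex.conj_eq_iff_re.mp ?_).symm
  have hc : ∀ s, starRingEnd ℂ (integrand A a B b x s)
      = integrand A a B b x (starRingEnd ℂ s) := fun s => (integrand_conj A a B b hx s).symm
  unfold foxHComplex leftLoopIntegral
  generalize abscissa A a = c
  generalize integrand A a B b x = F at hc ⊢
  have h1 : ∀ φ : ℝ, starRingEnd ℂ (∫ u in Set.Iic c, F (u + φ * Complex.I))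
      = ∫ u in Set.Iic c, F (u + ((-φ : ℝ) : ℂ) * Complex.I) := by
    intro φ
    rw [← integral_conj]
    refine MeasureTheory.integral_congr_ae (Filter.Eventually.of_forall fun u => ?_)
    simp [hc]
  have h2 : starRingEnd ℂ (∫ t in (-1 : ℝ)..1, F (c + t * Complex.I))
      = ∫ t in (-1 : ℝ)..1, F (c + t * Complex.I) := by
    have h3 : starRingEnd ℂ (∫ t in (-1 : ℝ)..1, F (c + t * Complex.I))
        = ∫ t in (-1 : ℝ)..1, F (c + ((-t : ℝ) : ℂ) * Complex.I) := by
      rw [← intervalIntegral.intervalIntegral_conj]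
      refine intervalIntegral.integral_congr fun t _ => ?_
      simp [hc]
    rw [h3, intervalIntegral.integral_comp_neg (fun t : ℝ => F (c + t * Complex.I))]
    simp
  have h4 := h1 (-1)
  have h5 := h1 1
  rw [neg_neg] at h4
  simp only [map_mul, map_inv₀, map_add, map_sub, h4, h5, h2,
    Complex.conj_I, Complex.conj_ofReal, map_ofNat]
  simp only [mul_neg, inv_neg]
  ring

/-- `Δ = ∑ⱼ Bⱼ - ∑ₖ Aₖ`. -/
def Delta (A : Fin p → ℝ) (B : Fin q → ℝ) : ℝ := ∑ j, B j - ∑ k, A k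

/-- `ρ = ∏ₖ Aₖ ^ Aₖ * ∏ⱼ Bⱼ ^ (-Bⱼ)`. -/
def rho (A : Fin p → ℝ) (B : Fin q → ℝ) : ℝ := (∏ k, A k ^ A k) * ∏ j, B j ^ (-B j)

/-- `μ = ∑ⱼ bⱼ - ∑ₖ aₖ + (p - q) / 2`. -/
def mu (a : Fin p → ℝ) (b : Fin q → ℝ) : ℝ := ∑ j, b j - ∑ k, a k + ((p : ℝ) - q) / 2

/-- `ν = (2π) ^ ((p - q) / 2) * ∏ₖ Aₖ ^ (aₖ - 1/2) * ∏ⱼ Bⱼ ^ (1/2 - bⱼ)`. -/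
def nu (A a : Fin p → ℝ) (B b : Fin q → ℝ) : ℝ :=
  (2 * Real.pi) ^ (((p : ℝ) - q) / 2) * (∏ k, A k ^ (a k - 1 / 2)) * ∏ j, B j ^ (1 / 2 - b j)

/-- The parameter set `S = {(a, b) : a ≥ 0, μ > 0}` in `ℝ^p × ℝ^q`. -/
def paramSet (p q : ℕ) : Set ((Fin p → ℝ) × (Fin q → ℝ)) :=
  {P | (∀ k, 0 ≤ P.1 k) ∧ 0 < mu P.1 P.2}

/-- The signed measure `H(x | a, b) dx` on `[0, ρ]`. -/
def foxMeasure (A a : Fin p → ℝ) (B b : Fin q → ℝ) : MeasureTheory.SignedMeasure ℝ :=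
  (MeasureTheory.volume.restrict (Set.Icc 0 (rho A B))).withDensityᵥ (foxH A a B b)

/-- The signed measure `ν ρ δ_ρ + H(x | a, b) dx` on `[0, ρ]`. -/
def limitMeasure (A a : Fin p → ℝ) (B b : Fin q → ℝ) : MeasureTheory.SignedMeasure ℝ :=
  MeasureTheory.VectorMeasure.dirac (rho A B) (nu A a B b * rho A B) + foxMeasure A a B b

/-- Weak convergence on `[α, β]` of the (restrictions to `[α, β]` of the) signed measures `m i` to
`m₀` along the filter `l`: convergence of the integrals over `[α, β]` of every function that is
continuous on `[α, β]`. -/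
def WeakConvergesOn {ι : Type*} (m : ι → MeasureTheory.SignedMeasure ℝ) (l : Filter ι)
    (m₀ : MeasureTheory.SignedMeasure ℝ) (α β : ℝ) : Prop :=
  ∀ f : ℝ → ℝ, ContinuousOn f (Set.Icc α β) →
    Filter.Tendsto
      (fun i => ((m i).restrict (Set.Icc α β)).integral f (ContinuousLinearMap.lsmul ℝ ℝ)) l
      (nhds ((m₀.restrict (Set.Icc α β)).integral f (ContinuousLinearMap.lsmul ℝ ℝ)))

end FoxH

end

/-!
Put `x = ρ e⁻ᵗ` with `t > 0`. When `Δ = 0`, Stirling's formula gives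
`gammaRatio s = ρ ^ s * ν * s ^ (-μ) * (1 + O(1 / |s|))` away from the poles, so that the integrand
is `ν s ^ (-μ) exp (t s)` up to that factor. The left loop can be moved to one of size `1 / t`, on
which Hankel's integral for `1 / Γ(μ)` gives `H = ν t ^ (μ - 1) / Γ(μ) + O(exp (t / 2))`, uniformly
for bounded parameters. As `μ → 0`, the remainder converges by dominated convergence, while
`t ^ (μ - 1) / Γ(μ)` behaves like the approximate identity `μ t ^ (μ - 1)` at `t = 0`, that is at
`x = ρ`, and produces the atom `ν ρ δ_ρ`.
-/

open Filter Topology MeasureTheory Complex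

namespace FoxH

/-- The points whose real part, or whose distance from the real axis, is at least `R`: the region
on which the error in Stirling's formula is `O(1 / R)`. -/
def farRegion (R : ℝ) : Set ℂ := {z | R ≤ z.re ∨ R ≤ |z.im|}

lemma mem_slitPlane_of_mem_farRegion {R : ℝ} (hR : 0 < R) {z : ℂ} (hz : z ∈ farRegion R) :
    z ∈ slitPlane := by
  rcases hz with h | h
  · exact Or.inl (hR.trans_le h)
  · exact Or.inr (abs_pos.mp (hR.trans_le h))

lemma le_norm_of_mem_farRegion {R : ℝ} {z : ℂ} (hz : z ∈ farRegion R) : R ≤ ‖z‖ := by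
  rcases hz with h | h
  · exact h.trans (re_le_norm z)
  · exact h.trans (abs_im_le_norm z)

lemma add_ofReal_mem_farRegion {R : ℝ} {z : ℂ} (hz : z ∈ farRegion R) {u : ℝ} (hu : 0 ≤ u) :
    z + u ∈ farRegion R := by
  rcases hz with h | h
  · left; simp; linarith
  · right; simpa using h

lemma ofReal_mul_mem_farRegion {α : ℝ} (hα : 0 ≤ α) {R : ℝ} {z : ℂ} (hz : z ∈ farRegion R) :
    α * z ∈ farRegion (α * R) := by
  rcases hz with h | h
  · left; rw [re_ofReal_mul]; gcongr
  · right; rw [im_ofReal_mul, abs_mul, abs_of_nonneg hα]; gcongr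

/-- The main part `(z - 1/2) log z - z` of the logarithm of the gamma function. -/
noncomputable def stirlingMain (z : ℂ) : ℂ := (z - 1 / 2) * log z - z

/-- The increment `(z + 1/2) (log (z + 1) - log z) - 1`, by which `stirlingMain` fails to satisfy
the functional equation of the logarithm of the gamma function. -/
noncomputable def stirlingStep (z : ℂ) : ℂ := (z + 1 / 2) * (log (z + 1) - log z) - 1

lemma stirlingMain_add_one (z : ℂ) :
    stirlingMain (z + 1) = stirlingMain z + log z + stirlingStep z := by
  unfold stirlingMain stirlingStep; ring

lemma stirlingStep_eq_integral {z : ℂ} (hz : ∀ u : ℝ, 0 ≤ u → z + u ∈ slitPlane) :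
    stirlingStep z = ∫ u in (0 : ℝ)..1, (u * (1 - u) / 2 : ℂ) / (z + u) ^ 2 := by
  have hne : ∀ u ∈ Set.uIcc (0 : ℝ) 1, z + u ≠ 0 := fun u hu =>
    slitPlane_ne_zero (hz u (by rw [Set.uIcc_of_le zero_le_one] at hu; exact hu.1))
  have hderiv : ∀ u ∈ Set.uIcc (0 : ℝ) 1, HasDerivAt
      (fun u : ℝ => (z + 1 / 2) * (log (z + u) - log z) - u - (u * (1 - u) / 2 : ℂ) / (z + u))
      ((u * (1 - u) / 2 : ℂ) / (z + u) ^ 2) u := by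
    intro u hu
    have hzu := hne u hu
    rw [Set.uIcc_of_le zero_le_one] at hu
    have h0 : HasDerivAt (fun u : ℝ => (u : ℂ)) 1 u := ofRealCLM.hasDerivAt
    have h1 : HasDerivAt (fun u : ℝ => z + (u : ℂ)) 1 u := h0.const_add z
    have h2 := h1.clog_real (hz u hu.1)
    have h3 := (h0.mul (h0.const_sub 1)).div_const 2
    refine ((((h2.sub_const (log z)).const_mul (z + 1 / 2)).sub h0).sub
      (h3.div h1 hzu)).congr_deriv ?_
    simp only [Pi.mul_apply]
    field_simp
    ring
  rw [intervalIntegral.integral_eq_sub_of_hasDerivAt hderiv]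
  · simp [stirlingStep]
  · refine (ContinuousOn.div (by fun_prop) (by fun_prop) fun u hu => ?_).intervalIntegrable
    exact pow_ne_zero 2 (hne u hu)

lemma continuousOn_inv_norm_add_sq {z : ℂ} (hz : ∀ u : ℝ, 0 ≤ u → z + u ∈ slitPlane) :
    ContinuousOn (fun u : ℝ => (‖z + u‖ ^ 2)⁻¹) (Set.Ici 0) :=
  ContinuousOn.inv₀ (by fun_prop) fun u hu =>
    pow_ne_zero 2 (norm_ne_zero_iff.mpr (slitPlane_ne_zero (hz u hu)))

lemma norm_stirlingStep_le {z : ℂ} (hz : ∀ u : ℝ, 0 ≤ u → z + u ∈ slitPlane) :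
    ‖stirlingStep z‖ ≤ 1 / 8 * ∫ u in (0 : ℝ)..1, (‖z + u‖ ^ 2)⁻¹ := by
  rw [stirlingStep_eq_integral hz, ← intervalIntegral.integral_const_mul]
  refine intervalIntegral.norm_integral_le_of_norm_le zero_le_one
    (Eventually.of_forall fun u hu => ?_)
    (((continuousOn_inv_norm_add_sq hz).mono ?_).intervalIntegrable.const_mul _)
  · have hker : ‖(u * (1 - u) / 2 : ℂ)‖ ≤ 1 / 8 := by
      rw [show (u * (1 - u) / 2 : ℂ) = ((u * (1 - u) / 2 : ℝ) : ℂ) by push_cast; ring,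
        norm_real, Real.norm_eq_abs, abs_of_nonneg]
      · nlinarith [sq_nonneg (u - 1 / 2)]
      · exact div_nonneg (mul_nonneg hu.1.le (sub_nonneg.mpr hu.2)) zero_le_two
    rw [norm_div, norm_pow, div_eq_mul_inv]
    gcongr
  · rw [Set.uIcc_of_le zero_le_one]
    exact Set.Icc_subset_Ici_self

lemma sum_norm_stirlingStep_le {z : ℂ} (hz : ∀ u : ℝ, 0 ≤ u → z + u ∈ slitPlane) (n : ℕ) :
    ∑ m ∈ Finset.range n, ‖stirlingStep (z + m)‖ ≤ 1 / 8 * ∫ u in (0 : ℝ)..n, (‖z + u‖ ^ 2)⁻¹ := by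
  have hsub : ∀ k : ℕ, Set.uIcc (k : ℝ) ((k + 1 : ℕ) : ℝ) ⊆ Set.Ici 0 := fun k u hu => by
    rw [Set.uIcc_of_le (by simp)] at hu
    exact k.cast_nonneg.trans hu.1
  have hsum := intervalIntegral.sum_integral_adjacent_intervals (μ := volume)
    (f := fun u : ℝ => (‖z + u‖ ^ 2)⁻¹) (a := fun k : ℕ => (k : ℝ)) (n := n) fun k _ =>
    ((continuousOn_inv_norm_add_sq hz).mono (hsub k)).intervalIntegrable
  rw [Nat.cast_zero] at hsum
  rw [← hsum, Finset.mul_sum]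
  refine Finset.sum_le_sum fun m _ => ?_
  have hshift := norm_stirlingStep_le (z := z + m) fun u hu => by
    simpa [add_assoc] using hz (m + u) (by positivity)
  have hint := intervalIntegral.integral_comp_add_left (a := 0) (b := 1)
    (fun u : ℝ => (‖z + u‖ ^ 2)⁻¹) m
  simp only [ofReal_add, ofReal_natCast, ← add_assoc, add_zero] at hint
  rwa [hint, ← Nat.cast_add_one] at hshift

lemma sq_norm_add_ofReal (z : ℂ) (u : ℝ) : ‖z + u‖ ^ 2 = (z.re + u) ^ 2 + z.im ^ 2 := by
  rw [Complex.sq_norm, normSq_apply]; simp; ring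

lemma integral_inv_norm_add_sq_le_of_re {R : ℝ} (hR : 0 < R) {z : ℂ} (hz : R ≤ z.re) (n : ℕ) :
    ∫ u in (0 : ℝ)..n, (‖z + u‖ ^ 2)⁻¹ ≤ 1 / R := by
  have hpos : ∀ u ∈ Set.Icc (0 : ℝ) n, 0 < z.re + u := fun u hu => by linarith [hu.1]
  have hslit : ∀ u : ℝ, 0 ≤ u → z + u ∈ slitPlane := fun u hu =>
    mem_slitPlane_of_mem_farRegion hR (add_ofReal_mem_farRegion (Or.inl hz) hu)
  have huIcc : Set.uIcc (0 : ℝ) n = Set.Icc (0 : ℝ) n := Set.uIcc_of_le n.cast_nonneg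
  have hint : IntervalIntegrable (fun u : ℝ => ((z.re + u) ^ 2)⁻¹) volume 0 n := by
    refine (ContinuousOn.inv₀ (by fun_prop) fun u hu => ?_).intervalIntegrable
    exact pow_ne_zero 2 (hpos u (huIcc ▸ hu)).ne'
  have hderiv : ∀ u ∈ Set.uIcc (0 : ℝ) n,
      HasDerivAt (fun u : ℝ => -(z.re + u)⁻¹) ((z.re + u) ^ 2)⁻¹ u := fun u hu => by
    have := (((hasDerivAt_id u).const_add z.re).inv (hpos u (huIcc ▸ hu)).ne').neg
    exact this.congr_deriv (by simp [neg_div])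
  calc ∫ u in (0 : ℝ)..n, (‖z + u‖ ^ 2)⁻¹
      ≤ ∫ u in (0 : ℝ)..n, ((z.re + u) ^ 2)⁻¹ := by
        refine intervalIntegral.integral_mono_on n.cast_nonneg
          ((continuousOn_inv_norm_add_sq hslit).mono ?_).intervalIntegrable hint fun u hu => ?_
        · exact huIcc ▸ Set.Icc_subset_Ici_self
        · have := hpos u hu
          rw [sq_norm_add_ofReal]
          gcongr
          exact le_add_of_nonneg_right (sq_nonneg _)
    _ = z.re⁻¹ - (z.re + n)⁻¹ := by
        rw [intervalIntegral.integral_eq_sub_of_hasDerivAt hderiv hint]; simp; ring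
    _ ≤ z.re⁻¹ := sub_le_self _ (inv_nonneg.mpr (hpos n ⟨n.cast_nonneg, le_rfl⟩).le)
    _ ≤ 1 / R := by rw [one_div]; gcongr

lemma integral_inv_norm_add_sq_le_of_abs_im {R : ℝ} (hR : 0 < R) {z : ℂ} (hz : R ≤ |z.im|)
    (s t : ℝ) : ∫ u in s..t, (‖z + u‖ ^ 2)⁻¹ ≤ Real.pi / R := by
  have him : 0 < |z.im| := hR.trans_le hz
  simp only [sq_norm_add_ofReal, ← sq_abs z.im]
  rw [intervalIntegral.integral_comp_add_left (fun u : ℝ => (u ^ 2 + |z.im| ^ 2)⁻¹)]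
  simp only [add_comm _ (|z.im| ^ 2)]
  rw [integral_inv_sq_add_sq him.ne']
  have h1 := Real.arctan_lt_pi_div_two ((z.re + t) / |z.im|)
  have h2 := Real.neg_pi_div_two_lt_arctan ((z.re + s) / |z.im|)
  calc |z.im|⁻¹ * (Real.arctan ((z.re + t) / |z.im|) - Real.arctan ((z.re + s) / |z.im|))
      ≤ |z.im|⁻¹ * Real.pi := by gcongr; linarith
    _ ≤ R⁻¹ * Real.pi := by gcongr
    _ = Real.pi / R := inv_mul_eq_div _ _

lemma norm_sum_stirlingStep_le {R : ℝ} (hR : 0 < R) {z : ℂ} (hz : z ∈ farRegion R) (n : ℕ) :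
    ‖∑ m ∈ Finset.range n, stirlingStep (z + m)‖ ≤ 1 / R := by
  have hint : ∫ u in (0 : ℝ)..n, (‖z + u‖ ^ 2)⁻¹ ≤ 4 / R := by
    rcases hz with h | h
    · exact (integral_inv_norm_add_sq_le_of_re hR h n).trans (by gcongr; norm_num)
    · exact (integral_inv_norm_add_sq_le_of_abs_im hR h 0 n).trans
        (by gcongr; exact Real.pi_lt_four.le)
  calc ‖∑ m ∈ Finset.range n, stirlingStep (z + m)‖
      ≤ ∑ m ∈ Finset.range n, ‖stirlingStep (z + m)‖ := norm_sum_le _ _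
    _ ≤ 1 / 8 * ∫ u in (0 : ℝ)..n, (‖z + u‖ ^ 2)⁻¹ := sum_norm_stirlingStep_le (fun u hu =>
        mem_slitPlane_of_mem_farRegion hR (add_ofReal_mem_farRegion hz hu)) n
    _ ≤ 1 / 8 * (4 / R) := by gcongr
    _ ≤ 1 / R := by rw [mul_div_assoc']; gcongr; norm_num

lemma prod_add_natCast_eq_exp {z : ℂ} (hz : ∀ m : ℕ, z + m ≠ 0) (n : ℕ) :
    ∏ j ∈ Finset.range n, (z + j) = exp (stirlingMain (z + n) - stirlingMain z
      - ∑ m ∈ Finset.range n, stirlingStep (z + m)) := by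
  induction n with
  | zero => simp
  | succ n ih =>
    rw [Finset.prod_range_succ, ih, Finset.sum_range_succ, ← exp_log (hz n), ← exp_add,
      exp_log (hz n), Nat.cast_succ, ← add_assoc, stirlingMain_add_one (z + n)]
    congr 1
    ring

lemma factorial_eq_stirlingSeq_mul_exp {n : ℕ} (hn : n ≠ 0) :
    (n.factorial : ℝ)
      = Stirling.stirlingSeq n * √2 * Real.exp ((n + 1 / 2) * Real.log n - n) := by
  have hn0 : (0 : ℝ) < n := by positivity
  have hexp : Real.exp ((n + 1 / 2) * Real.log n - n) = √n * (n / Real.exp 1) ^ n := by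
    rw [Real.exp_sub, mul_comm, ← Real.rpow_def_of_pos hn0, Real.rpow_add hn0, Real.rpow_natCast,
      ← Real.sqrt_eq_rpow, div_pow, ← Real.exp_nat_mul, mul_one]
    ring
  rw [hexp, Stirling.stirlingSeq, Real.sqrt_mul zero_le_two]
  field_simp

lemma tendsto_log_one_add_div_natCast (c : ℂ) :
    Tendsto (fun n : ℕ => log (1 + c / n)) atTop (𝓝 0) := by
  have hlog : ContinuousAt (fun s : ℂ => log (1 + s)) 0 :=
    ContinuousAt.clog (by fun_prop) (by simp)
  simpa [Function.comp_def] using hlog.tendsto.comp (tendsto_const_div_atTop_nhds_zero_nat c)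

lemma tendsto_natCast_mul_log_one_add_div (c : ℂ) :
    Tendsto (fun n : ℕ => (n : ℂ) * log (1 + c / n)) atTop (𝓝 c) := by
  refine tendsto_nat_mul_log_one_add_of_tendsto (g := fun n : ℕ => c / n)
    (tendsto_const_nhds.congr' ?_)
  filter_upwards [eventually_ne_atTop 0] with n hn
  field_simp

lemma eventually_log_add_natCast (c : ℂ) :
    ∀ᶠ n : ℕ in atTop, log (c + n) = Real.log n + log (1 + c / n) := by
  have hne : ∀ᶠ n : ℕ in atTop, 1 + c / (n : ℂ) ≠ 0 :=
    ((tendsto_const_div_atTop_nhds_zero_nat c).const_add 1).eventually_ne (by simp)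
  filter_upwards [eventually_gt_atTop 0, hne] with n hn hcn
  have hn0 : (0 : ℝ) < n := by exact_mod_cast hn
  rw [← log_ofReal_mul hn0 hcn, ofReal_natCast, mul_add, mul_one, mul_div_cancel₀ _
    (by exact_mod_cast hn.ne'), add_comm]

lemma tendsto_stirlingSeq_mul_exp (z : ℂ) :
    Tendsto (fun n : ℕ => (Stirling.stirlingSeq n * √2 : ℝ) * exp (z + 1
      - (z + 1 / 2) * log (1 + (z + 1) / n) - n * log (1 + (z + 1) / n))) atTop
      (𝓝 (√(2 * Real.pi) : ℝ)) := by
  have hseq : Tendsto (fun n : ℕ => ((Stirling.stirlingSeq n * √2 : ℝ) : ℂ)) atTop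
      (𝓝 ((√Real.pi * √2 : ℝ) : ℂ)) :=
    (continuous_ofReal.tendsto _).comp (Stirling.tendsto_stirlingSeq_sqrt_pi.mul_const _)
  have hexp := ((tendsto_const_nhds (x := z + 1)).sub
    ((tendsto_log_one_add_div_natCast (z + 1)).const_mul (z + 1 / 2))).sub
    (tendsto_natCast_mul_log_one_add_div (z + 1))
  rw [mul_zero, sub_zero, sub_self] at hexp
  have := hseq.mul ((continuous_exp.tendsto _).comp hexp)
  rwa [exp_zero, mul_one, mul_comm √Real.pi, ← Real.sqrt_mul zero_le_two] at this

lemma tendsto_natCast_cpow_mul_factorial_mul_exp (z : ℂ) :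
    Tendsto (fun n : ℕ => (n : ℂ) ^ z * (n.factorial : ℂ)
      * exp (-stirlingMain (z + (n + 1 : ℕ)))) atTop (𝓝 (√(2 * Real.pi) : ℝ)) := by
  refine (tendsto_stirlingSeq_mul_exp z).congr' ?_
  filter_upwards [eventually_ne_atTop 0, eventually_log_add_natCast (z + 1)] with n hn hlog
  have hadd : z + (n + 1 : ℕ) = z + 1 + n := by push_cast; ring
  rw [cpow_def_of_ne_zero (by exact_mod_cast hn), ← natCast_log, ← ofReal_natCast n.factorial,
    factorial_eq_stirlingSeq_mul_exp hn, stirlingMain, hadd, hlog, ofReal_mul _ (Real.exp _),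
    ofReal_exp, mul_left_comm, mul_assoc, ← exp_add, ← exp_add]
  congr 2
  push_cast
  ring

theorem exists_Gamma_eq_exp_stirlingMain {R : ℝ} (hR : 0 < R) {z : ℂ} (hz : z ∈ farRegion R) :
    ∃ J : ℂ, ‖J‖ ≤ 1 / R ∧ Gamma z = (√(2 * Real.pi) : ℝ) * exp (stirlingMain z + J) := by
  let J : ℕ → ℂ := fun n => ∑ m ∈ Finset.range (n + 1), stirlingStep (z + m)
  have hJ : ∀ n, J n ∈ Metric.closedBall (0 : ℂ) (1 / R) := fun n => by
    simpa using norm_sum_stirlingStep_le hR hz (n + 1)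
  -- Any limit point of the partial sums serves as the error term, so they need not converge.
  obtain ⟨J₀, hJ₀, φ, hφ, hlim⟩ := (isCompact_closedBall (0 : ℂ) (1 / R)).tendsto_subseq hJ
  refine ⟨J₀, by simpa using hJ₀, ?_⟩
  have hne : ∀ m : ℕ, z + m ≠ 0 := fun m => slitPlane_ne_zero
    (mem_slitPlane_of_mem_farRegion hR (by
      simpa using add_ofReal_mem_farRegion hz (u := m) m.cast_nonneg))
  have hseq : ∀ n, GammaSeq z n = ((n : ℂ) ^ z * (n.factorial : ℂ)
      * exp (-stirlingMain (z + (n + 1 : ℕ)))) * exp (stirlingMain z + J n) := by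
    intro n
    rw [GammaSeq, prod_add_natCast_eq_exp hne, div_eq_mul_inv, ← exp_neg, mul_assoc _ (exp _),
      ← exp_add]
    congr 2
    simp only [J]
    ring
  have hGamma := (GammaSeq_tendsto_Gamma z).comp hφ.tendsto_atTop
  have hprod := ((tendsto_natCast_cpow_mul_factorial_mul_exp z).comp hφ.tendsto_atTop).mul
    ((continuous_exp.tendsto _).comp (hlim.const_add (stirlingMain z)))
  exact tendsto_nhds_unique hGamma (hprod.congr fun n => (hseq (φ n)).symm)

section Perturbation

variable {w γ : ℂ} {r : ℝ}

lemma norm_log_add_mul_sub_log_le (hr : 0 < r)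
    (hslit : ∀ v ∈ Set.Icc (0 : ℝ) 1, w + v * γ ∈ slitPlane)
    (hnorm : ∀ v ∈ Set.Icc (0 : ℝ) 1, r ≤ ‖w + v * γ‖) {v : ℝ} (hv : v ∈ Set.Icc (0 : ℝ) 1) :
    ‖log (w + v * γ) - log w‖ ≤ ‖γ‖ / r := by
  have key := norm_image_sub_le_of_norm_deriv_le_segment' (a := 0) (b := 1) (C := ‖γ‖ / r)
    (f := fun v : ℝ => log (w + v * γ)) (f' := fun v : ℝ => (1 * γ) / (w + v * γ))
    (fun x hx => by
      have h0 : HasDerivAt (fun u : ℝ => (u : ℂ)) 1 x := ofRealCLM.hasDerivAt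
      exact (((h0.mul_const γ).const_add w).clog_real (hslit x hx)).hasDerivWithinAt)
    (fun x hx => by
      rw [one_mul, norm_div]
      gcongr
      exact hnorm x ⟨hx.1, hx.2.le⟩) v hv
  simp only [ofReal_zero, zero_mul, add_zero, sub_zero] at key
  exact key.trans (mul_le_of_le_one_right (by positivity) hv.2)

lemma norm_add_mul_log_sub_log_sub_le (hr : 0 < r)
    (hslit : ∀ v ∈ Set.Icc (0 : ℝ) 1, w + v * γ ∈ slitPlane)
    (hnorm : ∀ v ∈ Set.Icc (0 : ℝ) 1, r ≤ ‖w + v * γ‖) :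
    ‖(w + γ) * (log (w + γ) - log w) - γ‖ ≤ ‖γ‖ ^ 2 / r := by
  have key := norm_image_sub_le_of_norm_deriv_le_segment' (a := 0) (b := 1) (C := ‖γ‖ ^ 2 / r)
    (f := fun v : ℝ => (w + v * γ) * (log (w + v * γ) - log w) - v * γ)
    (f' := fun v : ℝ => γ * (log (w + v * γ) - log w))
    (fun x hx => by
      have h0 : HasDerivAt (fun u : ℝ => (u : ℂ)) 1 x := ofRealCLM.hasDerivAt
      have h1 := (h0.mul_const γ).const_add w
      have h2 := (h1.mul ((h1.clog_real (hslit x hx)).sub_const (log w))).sub (h0.mul_const γ)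
      refine (h2.congr_deriv ?_).hasDerivWithinAt
      rw [mul_div_cancel₀ _ (slitPlane_ne_zero (hslit x hx))]
      ring)
    (fun x hx => by
      rw [norm_mul, sq, mul_div_assoc]
      gcongr
      exact norm_log_add_mul_sub_log_le hr hslit hnorm ⟨hx.1, hx.2.le⟩) 1 (by simp)
  simpa using key

end Perturbation

lemma add_mul_ofReal_mem_farRegion {R γ : ℝ} (hR : 0 ≤ R) {w : ℂ}
    (hw : R ≤ |w.im| ∨ R ≤ w.re ∧ |γ| ≤ R / 2) {v : ℝ} (hv : v ∈ Set.Icc (0 : ℝ) 1) :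
    w + v * γ ∈ farRegion (R / 2) := by
  rcases hw with h | ⟨h, hγ⟩
  · right
    simpa using (half_le_self hR).trans h
  · left
    have hvγ : |v * γ| ≤ R / 2 := by
      rw [abs_mul, abs_of_nonneg hv.1]
      exact (mul_le_of_le_one_left (abs_nonneg _) hv.2).trans hγ
    have hre : (w + v * γ : ℂ).re = w.re + v * γ := by simp
    rw [hre]
    linarith [neg_abs_le (v * γ)]

lemma stirlingMain_ofReal_mul_add {α : ℝ} (hα : 0 < α) {w γ : ℂ} (hw : w + γ ≠ 0) :
    stirlingMain (α * (w + γ)) = (α * (w + γ) - 1 / 2) * (Real.log α + log w) - α * w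
      + (α * ((w + γ) * (log (w + γ) - log w) - γ) - (log (w + γ) - log w) / 2) := by
  rw [stirlingMain, log_ofReal_mul hα hw]
  ring

lemma norm_perturbation_le {α M R γ : ℝ} (hα : 0 < α) (hR : 0 < R) (hγ : |γ| ≤ M / α) {w : ℂ}
    (hw : R ≤ |w.im| ∨ R ≤ w.re ∧ |γ| ≤ R / 2) :
    ‖α * ((w + γ) * (log (w + γ) - log w) - γ) - (log (w + γ) - log w) / 2‖
      ≤ (2 * M ^ 2 + M) / α / R := by
  have hfar := fun v hv => add_mul_ofReal_mem_farRegion hR.le hw (v := v) hv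
  have hslit := fun v hv => mem_slitPlane_of_mem_farRegion (half_pos hR) (hfar v hv)
  have hnorm := fun v hv => le_norm_of_mem_farRegion (hfar v hv)
  have hlog := norm_log_add_mul_sub_log_le (half_pos hR) hslit hnorm
    (Set.right_mem_Icc.mpr zero_le_one)
  have hsq := norm_add_mul_log_sub_log_sub_le (half_pos hR) hslit hnorm
  simp only [ofReal_one, one_mul, norm_real, Real.norm_eq_abs] at hlog hsq
  have hmain : ‖(α * ((w + γ) * (log (w + γ) - log w) - γ) : ℂ)‖
      ≤ α * ((M / α) ^ 2 / (R / 2)) := by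
    rw [norm_mul, norm_real, Real.norm_of_nonneg hα.le]
    gcongr
    exact hsq.trans (by gcongr)
  have hhalf : ‖(log (w + γ) - log w) / 2‖ ≤ M / α / (R / 2) / 2 := by
    rw [norm_div, norm_ofNat]
    gcongr
    exact hlog.trans (by gcongr)
  refine (norm_sub_le _ _).trans ((add_le_add hmain hhalf).trans_eq ?_)
  field_simp

lemma ofReal_sqrt_two_pi : ((√(2 * Real.pi) : ℝ) : ℂ) = exp ((Real.log (2 * Real.pi) : ℝ) / 2) := by
  rw [Real.sqrt_eq_rpow, Real.rpow_def_of_pos (by positivity), ofReal_exp]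
  congr 1
  push_cast
  ring

lemma exists_Gamma_mul_add_eq_exp {α β M R : ℝ} (hα : 0 < α) (hβ : |β| ≤ M) (hR : 0 < R) {w : ℂ}
    (hw : R ≤ |w.im| ∨ (R ≤ w.re ∧ 2 * M ≤ α * R)) :
    ∃ E : ℂ, ‖E‖ ≤ (2 * M ^ 2 + M + 2) / α / R ∧ Gamma (α * w + β) =
      exp ((Real.log (2 * Real.pi) : ℝ) / 2
        + (α * w + β - 1 / 2) * (Real.log α + log w) - α * w + E) := by
  obtain ⟨γ, rfl⟩ : ∃ γ : ℝ, β = α * γ := ⟨β / α, by field_simp⟩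
  have hγ : |γ| ≤ M / α := by
    rwa [abs_mul, abs_of_pos hα, mul_comm, ← le_div_iff₀ hα] at hβ
  have hw' : R ≤ |w.im| ∨ R ≤ w.re ∧ |γ| ≤ R / 2 := hw.imp_right fun ⟨h, hMR⟩ =>
    ⟨h, hγ.trans (by rw [div_le_iff₀ hα]; linarith only [hMR])⟩
  have hfar : w + γ ∈ farRegion (R / 2) := by
    simpa using add_mul_ofReal_mem_farRegion hR.le hw' (Set.right_mem_Icc.mpr zero_le_one)
  have hne := slitPlane_ne_zero (mem_slitPlane_of_mem_farRegion (half_pos hR) hfar)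
  obtain ⟨J, hJ, hΓ⟩ := exists_Gamma_eq_exp_stirlingMain (mul_pos hα (half_pos hR))
    (ofReal_mul_mem_farRegion hα.le hfar)
  refine ⟨α * ((w + γ) * (log (w + γ) - log w) - γ) - (log (w + γ) - log w) / 2 + J, ?_, ?_⟩
  · refine (norm_add_le _ _).trans
      ((add_le_add (norm_perturbation_le hα hR hγ hw') hJ).trans_eq ?_)
    field_simp
  · rw [ofReal_mul, ← mul_add, hΓ, ofReal_sqrt_two_pi, ← exp_add,
      stirlingMain_ofReal_mul_add hα hne]
    congr 1
    ring

section GammaRatio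

variable {p q : ℕ} {A a : Fin p → ℝ} {B b : Fin q → ℝ}

/-- The positivity of the scale parameters and the neutrality `Δ = 0`. -/
structure IsDeltaNeutral (A : Fin p → ℝ) (B : Fin q → ℝ) : Prop where
  pos_left : ∀ k, 0 < A k
  pos_right : ∀ j, 0 < B j
  delta_eq_zero : Delta A B = 0

/-- The constant `C` in the error bound `C / R` for the gamma ratio with shifts at most `M`. -/
noncomputable def errorConst (A : Fin p → ℝ) (B : Fin q → ℝ) (M : ℝ) : ℝ :=
  ∑ k, (2 * M ^ 2 + M + 2) / A k + ∑ j, (2 * M ^ 2 + M + 2) / B j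

/-- The gamma ratio divided by `ρ ^ s`. -/
noncomputable def normRatio (A a : Fin p → ℝ) (B b : Fin q → ℝ) (s : ℂ) : ℂ :=
  gammaRatio A a B b s * exp (-(Real.log (rho A B) : ℝ) * s)

lemma errorConst_nonneg (hAB : IsDeltaNeutral A B) {M : ℝ} (hM : 0 ≤ M) :
    0 ≤ errorConst A B M :=
  add_nonneg (Finset.sum_nonneg fun k _ => by have := hAB.pos_left k; positivity)
    (Finset.sum_nonneg fun j _ => by have := hAB.pos_right j; positivity)

lemma rho_pos (hAB : IsDeltaNeutral A B) : 0 < rho A B :=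
  mul_pos (Finset.prod_pos fun k _ => Real.rpow_pos_of_pos (hAB.pos_left k) _)
    (Finset.prod_pos fun j _ => Real.rpow_pos_of_pos (hAB.pos_right j) _)

lemma log_rho (hAB : IsDeltaNeutral A B) :
    Real.log (rho A B) = ∑ k, Real.log (A k) * A k - ∑ j, Real.log (B j) * B j := by
  have hA : ∀ k, 0 < A k ^ A k := fun k => Real.rpow_pos_of_pos (hAB.pos_left k) _
  have hB : ∀ j, 0 < B j ^ (-B j) := fun j => Real.rpow_pos_of_pos (hAB.pos_right j) _
  rw [rho, Real.log_mul (Finset.prod_pos fun k _ => hA k).ne'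
    (Finset.prod_pos fun j _ => hB j).ne', Real.log_prod fun k _ => (hA k).ne',
    Real.log_prod fun j _ => (hB j).ne', sub_eq_add_neg, ← Finset.sum_neg_distrib]
  congr 1
  · exact Finset.sum_congr rfl fun k _ => by rw [Real.log_rpow (hAB.pos_left k), mul_comm]
  · exact Finset.sum_congr rfl fun j _ => by
      rw [Real.log_rpow (hAB.pos_right j), neg_mul, mul_comm]

lemma nu_eq_exp (hAB : IsDeltaNeutral A B) (a : Fin p → ℝ) (b : Fin q → ℝ) :
    nu A a B b = Real.exp (Real.log (2 * Real.pi) * (((p : ℝ) - q) / 2)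
      + ∑ k, Real.log (A k) * (a k - 1 / 2) + ∑ j, Real.log (B j) * (1 / 2 - b j)) := by
  rw [nu, Real.exp_add, Real.exp_add, Real.exp_sum, Real.exp_sum,
    Real.rpow_def_of_pos (by positivity)]
  congr 2
  · exact Finset.prod_congr rfl fun k _ => Real.rpow_def_of_pos (hAB.pos_left k) _
  · exact funext fun j => Real.rpow_def_of_pos (hAB.pos_right j) _

lemma sum_stirling_exponent (w : ℂ) {n : ℕ} (α β : Fin n → ℝ) (e : Fin n → ℂ) :
    ∑ k, ((Real.log (2 * Real.pi) : ℝ) / 2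
      + (α k * w + β k - 1 / 2) * (Real.log (α k) + log w) - α k * w + e k)
    = n * ((Real.log (2 * Real.pi) : ℝ) / 2) + w * (∑ k, Real.log (α k) * α k : ℝ)
      + (∑ k, Real.log (α k) * (β k - 1 / 2) : ℝ) + (w * log w - w) * (∑ k, α k : ℝ)
      + log w * (∑ k, β k : ℝ) - n * (log w / 2) + ∑ k, e k := by
  have hconst : ∀ c : ℂ, n * c = ∑ _k : Fin n, c := fun c => by simp
  push_cast
  simp only [hconst, Finset.mul_sum, ← Finset.sum_add_distrib, ← Finset.sum_sub_distrib]
  exact Finset.sum_congr rfl fun k _ => by ring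

theorem exists_normRatio_eq (hAB : IsDeltaNeutral A B) {M R : ℝ} (ha : ∀ k, |a k| ≤ M)
    (hb : ∀ j, |b j| ≤ M) (hR : 0 < R) {w : ℂ}
    (hw : R ≤ |w.im| ∨ (R ≤ w.re ∧ (∀ k, 2 * M ≤ A k * R) ∧ ∀ j, 2 * M ≤ B j * R)) :
    ∃ E : ℂ, ‖E‖ ≤ errorConst A B M / R ∧
      normRatio A a B b w = nu A a B b * w ^ (-(mu a b : ℂ)) * exp E := by
  have hw0 : w ≠ 0 := slitPlane_ne_zero (mem_slitPlane_of_mem_farRegion hR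
    (hw.symm.imp_left And.left))
  choose E hE hΓ using fun k => exists_Gamma_mul_add_eq_exp (w := w) (hAB.pos_left k) (ha k) hR
    (hw.imp_right fun h => ⟨h.1, h.2.1 k⟩)
  choose E' hE' hΓ' using fun j => exists_Gamma_mul_add_eq_exp (w := w) (hAB.pos_right j) (hb j) hR
    (hw.imp_right fun h => ⟨h.1, h.2.2 j⟩)
  refine ⟨∑ k, E k - ∑ j, E' j, ?_, ?_⟩
  · rw [errorConst, add_div, Finset.sum_div, Finset.sum_div]
    exact (norm_sub_le _ _).trans (add_le_add (norm_sum_le_of_le _ fun k _ => hE k)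
      (norm_sum_le_of_le _ fun j _ => hE' j))
  · have hneg : ∑ j, Real.log (B j) * (1 / 2 - b j) = -∑ j, Real.log (B j) * (b j - 1 / 2) := by
      rw [← Finset.sum_neg_distrib]
      exact Finset.sum_congr rfl fun j _ => by ring
    simp only [normRatio, gammaRatio, hΓ, hΓ', ← exp_sum, ← exp_sub, ← exp_add]
    rw [nu_eq_exp hAB, log_rho hAB, cpow_def_of_ne_zero hw0, ofReal_exp, ← exp_add, ← exp_add,
      sum_stirling_exponent, sum_stirling_exponent, hneg, sub_eq_zero.mp hAB.delta_eq_zero, mu]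
    congr 1
    push_cast
    ring

end GammaRatio

section ExpDecay

variable {f : ℝ → ℂ} {t C c : ℝ}

lemma integrableOn_Iic_of_norm_le_exp (ht : 0 < t) (hf : ContinuousOn f (Set.Iic c))
    (hC : ∀ u ≤ c, ‖f u‖ ≤ C * Real.exp (t * u)) : IntegrableOn f (Set.Iic c) := by
  refine Integrable.mono' ((integrableOn_exp_mul_Iic ht c).const_mul C)
    (hf.aestronglyMeasurable measurableSet_Iic) ?_
  filter_upwards [ae_restrict_mem measurableSet_Iic] with u hu using hC u hu

lemma norm_integral_Iic_le_of_norm_le_exp (ht : 0 < t)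
    (hC : ∀ u ≤ c, ‖f u‖ ≤ C * Real.exp (t * u)) :
    ‖∫ u in Set.Iic c, f u‖ ≤ C * (Real.exp (t * c) / t) := by
  rw [← integral_exp_mul_Iic ht, ← integral_const_mul]
  refine norm_integral_le_of_norm_le ((integrableOn_exp_mul_Iic ht c).const_mul C) ?_
  filter_upwards [ae_restrict_mem measurableSet_Iic] with u hu using hC u hu

lemma tendsto_const_mul_exp_mul_atBot (ht : 0 < t) (C : ℝ) :
    Tendsto (fun u : ℝ => C * Real.exp (t * u)) atBot (𝓝 0) := by
  simpa using (Real.tendsto_exp_atBot.comp (tendsto_id.const_mul_atBot ht)).const_mul C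

end ExpDecay

lemma tendsto_integral_vertical_atBot {F : ℂ → ℂ} {t C c φ φ' : ℝ} (ht : 0 < t)
    (hC : ∀ w ∈ Set.Iic c ×ℂ Set.uIcc φ φ', ‖F w‖ ≤ C * Real.exp (t * w.re)) :
    Tendsto (fun N : ℝ => ∫ y in φ..φ', F (N + y * I)) atBot (𝓝 0) := by
  have hexp := (tendsto_const_mul_exp_mul_atBot ht C).mul_const |φ' - φ|
  rw [zero_mul] at hexp
  refine squeeze_zero_norm' ?_ hexp
  filter_upwards [eventually_le_atBot c] with N hN
  refine intervalIntegral.norm_integral_le_of_norm_le_const fun y hy => ?_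
  simpa using hC (N + y * I) (by simpa [mem_reProdIm] using ⟨hN, Set.uIoc_subset_uIcc hy⟩)

lemma integral_boundary_strip_eq_zero {F : ℂ → ℂ} {t C c φ φ' : ℝ} (ht : 0 < t)
    (hF : DifferentiableOn ℂ F (Set.Iic c ×ℂ Set.uIcc φ φ'))
    (hC : ∀ w ∈ Set.Iic c ×ℂ Set.uIcc φ φ', ‖F w‖ ≤ C * Real.exp (t * w.re)) :
    (∫ u in Set.Iic c, F (u + φ * I)) - (∫ u in Set.Iic c, F (u + φ' * I))
      + I * ∫ y in φ..φ', F (c + y * I) = 0 := by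
  have hside : ∀ y ∈ Set.uIcc φ φ', Tendsto (fun N : ℝ => ∫ u in N..c, F (u + y * I)) atBot
      (𝓝 (∫ u in Set.Iic c, F (u + y * I))) := by
    intro y hy
    have hmem : ∀ u ≤ c, (u : ℂ) + y * I ∈ Set.Iic c ×ℂ Set.uIcc φ φ' := fun u hu => by
      simpa [mem_reProdIm] using ⟨hu, hy⟩
    refine intervalIntegral_tendsto_integral_Iic c (integrableOn_Iic_of_norm_le_exp (C := C) ht
      (hF.continuousOn.comp (by fun_prop) hmem) fun u hu => ?_) tendsto_id
    simpa using hC _ (hmem u hu)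
  have hlim := (((hside φ Set.left_mem_uIcc).sub (hside φ' Set.right_mem_uIcc)).add_const
    (I * ∫ y in φ..φ', F (c + y * I))).sub
    ((tendsto_integral_vertical_atBot ht hC).const_mul I)
  rw [mul_zero, sub_zero] at hlim
  refine tendsto_nhds_unique hlim (tendsto_const_nhds.congr' ?_)
  filter_upwards [eventually_le_atBot c] with N hN
  refine (integral_boundary_rect_eq_zero_of_differentiableOn F ⟨N, φ⟩ ⟨c, φ'⟩ (hF.mono ?_)).symm
  rw [Set.uIcc_of_le hN]
  exact Set.inter_subset_inter_left _ (Set.preimage_mono Set.Icc_subset_Iic_self)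

lemma add_mul_I_mem_slitPlane_of_pos {c : ℝ} (hc : 0 < c) (y : ℝ) : (c : ℂ) + y * I ∈ slitPlane :=
  Or.inl (by simpa using hc)

lemma add_mul_I_mem_slitPlane_of_ne_zero {y : ℝ} (hy : y ≠ 0) (u : ℝ) :
    (u : ℂ) + y * I ∈ slitPlane :=
  Or.inr (by simpa using hy)

/-- Holomorphic functions on the slit plane that decay like `exp (t * re w)` to the left, uniformly
away from the real axis. Their left loop integrals converge and do not depend on the loop. -/
structure LoopAdmissible (F : ℂ → ℂ) (t : ℝ) : Prop where
  differentiableOn : DifferentiableOn ℂ F slitPlane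
  bound : ∀ δ : ℝ, 0 < δ → ∃ C : ℝ, ∀ w : ℂ, δ ≤ |w.im| → ‖F w‖ ≤ C * Real.exp (t * w.re)

namespace LoopAdmissible

variable {F G : ℂ → ℂ} {t φ φ' c c' : ℝ}

lemma integrableOn (hF : LoopAdmissible F t) (ht : 0 < t) {y : ℝ} (hy : y ≠ 0) (c : ℝ) :
    IntegrableOn (fun u : ℝ => F (u + y * I)) (Set.Iic c) := by
  obtain ⟨C, hC⟩ := hF.bound |y| (abs_pos.mpr hy)
  refine integrableOn_Iic_of_norm_le_exp (C := C) ht (hF.differentiableOn.continuousOn.comp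
    (by fun_prop) fun u _ => add_mul_I_mem_slitPlane_of_ne_zero hy u) fun u _ => ?_
  simpa using hC (u + y * I) (by simp)

lemma intervalIntegrable (hF : LoopAdmissible F t) (hc : 0 < c) (y₁ y₂ : ℝ) :
    IntervalIntegrable (fun y : ℝ => F (c + y * I)) volume y₁ y₂ :=
  (hF.differentiableOn.continuousOn.comp_continuous (by fun_prop)
    (add_mul_I_mem_slitPlane_of_pos hc)).intervalIntegrable _ _

lemma sub (hF : LoopAdmissible F t) (hG : LoopAdmissible G t) :
    LoopAdmissible (fun w => F w - G w) t where
  differentiableOn := hF.differentiableOn.sub hG.differentiableOn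
  bound δ hδ := by
    obtain ⟨C, hC⟩ := hF.bound δ hδ
    obtain ⟨C', hC'⟩ := hG.bound δ hδ
    refine ⟨C + C', fun w hw => (norm_sub_le _ _).trans ?_⟩
    rw [add_mul]
    exact add_le_add (hC w hw) (hC' w hw)

lemma const_mul (hF : LoopAdmissible F t) (a : ℂ) : LoopAdmissible (fun w => a * F w) t where
  differentiableOn := hF.differentiableOn.const_mul a
  bound δ hδ := by
    obtain ⟨C, hC⟩ := hF.bound δ hδ
    refine ⟨‖a‖ * C, fun w hw => ?_⟩
    rw [norm_mul, mul_assoc]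
    exact mul_le_mul_of_nonneg_left (hC w hw) (norm_nonneg a)

lemma leftLoopIntegral_sub (hF : LoopAdmissible F t) (hG : LoopAdmissible G t) (ht : 0 < t)
    (hφ : 0 < φ) (hc : 0 < c) :
    leftLoopIntegral (fun w => F w - G w) (-φ) φ c
      = leftLoopIntegral F (-φ) φ c - leftLoopIntegral G (-φ) φ c := by
  have hφ' : -φ ≠ 0 := neg_ne_zero.mpr hφ.ne'
  unfold leftLoopIntegral
  rw [integral_sub (hF.integrableOn ht hφ' c) (hG.integrableOn ht hφ' c),
    integral_sub (hF.integrableOn ht hφ.ne' c) (hG.integrableOn ht hφ.ne' c),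
    intervalIntegral.integral_sub (hF.intervalIntegrable hc _ _) (hG.intervalIntegrable hc _ _)]
  ring

lemma leftLoopIntegral_eq_of_abscissa (hF : LoopAdmissible F t) (ht : 0 < t)
    (hφ : 0 < φ) (hc : 0 < c) (hc' : 0 < c') :
    leftLoopIntegral F (-φ) φ c = leftLoopIntegral F (-φ) φ c' := by
  have hφ' : -φ ≠ 0 := neg_ne_zero.mpr hφ.ne'
  have hrect := integral_boundary_rect_eq_zero_of_differentiableOn F ⟨c, -φ⟩ ⟨c', φ⟩
    (hF.differentiableOn.mono fun w hw => Or.inl ((lt_min hc hc').trans_le hw.1.1))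
  simp only [smul_eq_mul] at hrect
  have hlow := intervalIntegral.integral_Iic_sub_Iic
    (hF.integrableOn ht hφ' c) (hF.integrableOn ht hφ' c')
  have hup := intervalIntegral.integral_Iic_sub_Iic
    (hF.integrableOn ht hφ.ne' c) (hF.integrableOn ht hφ.ne' c')
  unfold leftLoopIntegral
  linear_combination hup - hlow - hrect

lemma leftLoopIntegral_eq_of_height (hF : LoopAdmissible F t) (ht : 0 < t)
    (hφ : 0 < φ) (hφ' : 0 < φ') (hc : 0 < c) :
    leftLoopIntegral F (-φ) φ c = leftLoopIntegral F (-φ') φ' c := by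
  have hδ : 0 < min φ φ' := lt_min hφ hφ'
  obtain ⟨C, hC⟩ := hF.bound (min φ φ') hδ
  have hstrip : ∀ ψ ψ' : ℝ, (∀ y ∈ Set.uIcc ψ ψ', min φ φ' ≤ |y|) →
      (∫ u in Set.Iic c, F (u + ψ * I)) - (∫ u in Set.Iic c, F (u + ψ' * I))
      + I * ∫ y in ψ..ψ', F (c + y * I) = 0 := fun ψ ψ' h =>
    integral_boundary_strip_eq_zero (C := C) ht
      (hF.differentiableOn.mono fun w hw => Or.inr (abs_pos.mp (hδ.trans_le (h _ hw.2))))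
      fun w hw => hC w (h _ hw.2)
  have hup := hstrip φ φ' fun y hy => hy.1.trans (le_abs_self y)
  have hlow := hstrip (-φ) (-φ') fun y hy => by
    have := hy.2
    rw [max_neg_neg] at this
    exact le_abs.mpr (Or.inr (le_neg_of_le_neg this))
  have hii := hF.intervalIntegrable hc
  have hleft := intervalIntegral.integral_add_adjacent_intervals (hii (-φ) (-φ')) (hii (-φ') φ')
  have hright := intervalIntegral.integral_add_adjacent_intervals (hii (-φ) φ) (hii φ φ')
  unfold leftLoopIntegral
  linear_combination hlow - hup + I * (hright - hleft)

lemma leftLoopIntegral_eq (hF : LoopAdmissible F t) (ht : 0 < t)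
    (hφ : 0 < φ) (hφ' : 0 < φ') (hc : 0 < c) (hc' : 0 < c') :
    leftLoopIntegral F (-φ) φ c = leftLoopIntegral F (-φ') φ' c' :=
  (hF.leftLoopIntegral_eq_of_height ht hφ hφ' hc).trans
    (hF.leftLoopIntegral_eq_of_abscissa ht hφ' hc hc')

lemma integral_horizontal_of_hasDerivAt {F' : ℂ → ℂ} (hF : LoopAdmissible F t)
    (hF' : LoopAdmissible F' t) (ht : 0 < t) (hderiv : ∀ w ∈ slitPlane, HasDerivAt F (F' w) w)
    {y : ℝ} (hy : y ≠ 0) (c : ℝ) : ∫ u in Set.Iic c, F' (u + y * I) = F (c + y * I) := by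
  obtain ⟨C, hC⟩ := hF.bound |y| (abs_pos.mpr hy)
  have hlim : Tendsto (fun u : ℝ => F (u + y * I)) atBot (𝓝 0) :=
    squeeze_zero_norm (fun u => by simpa using hC (u + y * I) (by simp))
      (tendsto_const_mul_exp_mul_atBot ht C)
  refine (integral_Iic_of_hasDerivAt_of_tendsto' (fun u _ => ?_) (hF'.integrableOn ht hy c)
    hlim).trans (sub_zero _)
  have hline : HasDerivAt (fun u : ℝ => (u : ℂ) + y * I) 1 u := ofRealCLM.hasDerivAt.add_const _
  simpa [Function.comp_def] using
    (hderiv _ (add_mul_I_mem_slitPlane_of_ne_zero hy u)).comp u hline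

lemma leftLoopIntegral_eq_zero_of_hasDerivAt {F' : ℂ → ℂ} (hF : LoopAdmissible F t)
    (hF' : LoopAdmissible F' t) (ht : 0 < t) (hderiv : ∀ w ∈ slitPlane, HasDerivAt F (F' w) w)
    (hφ : 0 < φ) (hc : 0 < c) : leftLoopIntegral F' (-φ) φ c = 0 := by
  have hver : I * ∫ y in (-φ)..φ, F' (c + y * I) = F (c + φ * I) - F (c + (-φ : ℝ) * I) := by
    rw [← intervalIntegral.integral_const_mul]
    refine intervalIntegral.integral_eq_sub_of_hasDerivAt (f := fun y : ℝ => F (c + y * I))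
      (fun y _ => ?_) ((hF'.intervalIntegrable hc _ _).const_mul I)
    have hline : HasDerivAt (fun y : ℝ => (c : ℂ) + y * I) (1 * I) y :=
      (ofRealCLM.hasDerivAt.mul_const I).const_add _
    simpa [mul_comm, Function.comp_def] using
      (hderiv _ (add_mul_I_mem_slitPlane_of_pos hc y)).comp y hline
  rw [leftLoopIntegral, hver,
    hF.integral_horizontal_of_hasDerivAt hF' ht hderiv (neg_ne_zero.mpr hφ.ne'),
    hF.integral_horizontal_of_hasDerivAt hF' ht hderiv hφ.ne']
  ring

end LoopAdmissible

lemma norm_leftLoopIntegral_le {F : ℂ → ℂ} {t C C' φ c : ℝ} (ht : 0 < t) (hφ : 0 < φ)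
    (hhor : ∀ u ≤ c, ∀ y : ℝ, |y| = φ → ‖F (u + y * I)‖ ≤ C * Real.exp (t * u))
    (hver : ∀ y : ℝ, |y| ≤ φ → ‖F (c + y * I)‖ ≤ C') :
    ‖leftLoopIntegral F (-φ) φ c‖ ≤ 2 * C * (Real.exp (t * c) / t) + 2 * φ * C' := by
  have hlow := norm_integral_Iic_le_of_norm_le_exp ht fun u hu =>
    hhor u hu (-φ) (by rw [abs_neg, abs_of_pos hφ])
  have hup := norm_integral_Iic_le_of_norm_le_exp ht fun u hu => hhor u hu φ (abs_of_pos hφ)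
  have hside : ‖I * ∫ y in (-φ)..φ, F (c + y * I)‖ ≤ 2 * φ * C' := by
    rw [norm_mul, norm_I, one_mul]
    refine (intervalIntegral.norm_integral_le_of_norm_le_const fun y hy => hver y ?_).trans_eq ?_
    · rw [Set.uIoc_of_le (by linarith)] at hy
      exact abs_le.mpr ⟨hy.1.le, hy.2⟩
    · rw [sub_neg_eq_add, abs_of_pos (by positivity)]
      ring
  rw [leftLoopIntegral]
  linarith [norm_sub_le ((∫ u in Set.Iic c, F (u + (-φ : ℝ) * I))
      + I * ∫ y in (-φ)..φ, F (c + y * I)) (∫ u in Set.Iic c, F (u + φ * I)),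
    norm_add_le (∫ u in Set.Iic c, F (u + (-φ : ℝ) * I)) (I * ∫ y in (-φ)..φ, F (c + y * I))]

section DominatedConvergence

variable {ι : Type*} {l : Filter ι} [l.IsCountablyGenerated] {F : ι → ℂ → ℂ} {G : ℂ → ℂ}
  {t C φ c : ℝ}

lemma tendsto_integral_horizontal (ht : 0 < t)
    (hcont : ∀ᶠ i in l, ContinuousOn (F i) slitPlane) {y : ℝ} (hy : y ≠ 0)
    (hbound : ∀ᶠ i in l, ∀ u ≤ c, ‖F i (u + y * I)‖ ≤ C * Real.exp (t * u))
    (hlim : ∀ w ∈ slitPlane, Tendsto (fun i => F i w) l (𝓝 (G w))) :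
    Tendsto (fun i => ∫ u in Set.Iic c, F i (u + y * I)) l
      (𝓝 (∫ u in Set.Iic c, G (u + y * I))) := by
  refine tendsto_integral_filter_of_dominated_convergence (fun u => C * Real.exp (t * u)) ?_ ?_
    ((integrableOn_exp_mul_Iic ht c).const_mul C)
    (Eventually.of_forall fun u => hlim _ (add_mul_I_mem_slitPlane_of_ne_zero hy u))
  · filter_upwards [hcont] with i hi
    exact (hi.comp_continuous (by fun_prop)
      (add_mul_I_mem_slitPlane_of_ne_zero hy)).aestronglyMeasurable
  · filter_upwards [hbound] with i hi
    filter_upwards [ae_restrict_mem measurableSet_Iic] with u hu using hi u hu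

lemma tendsto_leftLoopIntegral (ht : 0 < t) (hφ : 0 < φ) (hc : 0 < c)
    (hcont : ∀ᶠ i in l, ContinuousOn (F i) slitPlane)
    (hhor : ∀ᶠ i in l, ∀ u ≤ c, ∀ y : ℝ, |y| = φ → ‖F i (u + y * I)‖ ≤ C * Real.exp (t * u))
    (hver : ∀ᶠ i in l, ∀ y : ℝ, |y| ≤ φ → ‖F i (c + y * I)‖ ≤ C)
    (hlim : ∀ w ∈ slitPlane, Tendsto (fun i => F i w) l (𝓝 (G w))) :
    Tendsto (fun i => leftLoopIntegral (F i) (-φ) φ c) l (𝓝 (leftLoopIntegral G (-φ) φ c)) := by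
  have hleg : ∀ y : ℝ, |y| = φ → Tendsto (fun i => ∫ u in Set.Iic c, F i (u + y * I)) l
      (𝓝 (∫ u in Set.Iic c, G (u + y * I))) := fun y hy =>
    tendsto_integral_horizontal ht hcont (abs_pos.mp (hy ▸ hφ))
      (hhor.mono fun i hi u hu => hi u hu y hy) hlim
  have hside : Tendsto (fun i => ∫ y in (-φ)..φ, F i (c + y * I)) l
      (𝓝 (∫ y in (-φ)..φ, G (c + y * I))) := by
    refine intervalIntegral.tendsto_integral_filter_of_dominated_convergence (fun _ => C) ?_ ?_
      intervalIntegrable_const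
      (Eventually.of_forall fun y _ => hlim _ (add_mul_I_mem_slitPlane_of_pos hc y))
    · filter_upwards [hcont] with i hi
      exact (hi.comp_continuous (by fun_prop)
        (add_mul_I_mem_slitPlane_of_pos hc)).aestronglyMeasurable
    · filter_upwards [hver] with i hi
      refine Eventually.of_forall fun y hy => hi y ?_
      rw [Set.uIoc_of_le (by linarith)] at hy
      exact abs_le.mpr ⟨hy.1.le, hy.2⟩
  exact ((hleg (-φ) (by rw [abs_neg, abs_of_pos hφ])).add (hside.const_mul I)).sub
    (hleg φ (abs_of_pos hφ))

end DominatedConvergence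

lemma leftLoopIntegral_const_mul (a : ℂ) (F : ℂ → ℂ) (φ₁ φ₂ c : ℝ) :
    leftLoopIntegral (fun w => a * F w) φ₁ φ₂ c = a * leftLoopIntegral F φ₁ φ₂ c := by
  unfold leftLoopIntegral
  rw [integral_const_mul, integral_const_mul, intervalIntegral.integral_const_mul]
  ring

lemma leftLoopIntegral_comp_mul (F : ℂ → ℂ) {r : ℝ} (hr : 0 < r) (φ₁ φ₂ c : ℝ) :
    leftLoopIntegral (fun w => F (r * w)) φ₁ φ₂ c
      = (r : ℂ)⁻¹ * leftLoopIntegral F (r * φ₁) (r * φ₂) (r * c) := by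
  have hpoint : ∀ x y : ℝ, F (r * (x + y * I)) = F ((r * x : ℝ) + (r * y : ℝ) * I) :=
    fun x y => by congr 1; push_cast; ring
  have hhor : ∀ y : ℝ, ∫ u in Set.Iic c, F (r * (u + y * I))
      = (r : ℂ)⁻¹ * ∫ u in Set.Iic (r * c), F (u + (r * y : ℝ) * I) := by
    intro y
    have h := Measure.setIntegral_comp_smul_of_pos volume
      (fun u : ℝ => F (u + (r * y : ℝ) * I)) (Set.Iic c) hr
    simp only [LinearOrderedField.smul_Iic hr, Module.finrank_self, pow_one, smul_eq_mul,
      real_smul, ofReal_inv] at h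
    simp only [hpoint, h]
  have hver : ∫ y in φ₁..φ₂, F (r * (c + y * I))
      = (r : ℂ)⁻¹ * ∫ y in (r * φ₁)..(r * φ₂), F ((r * c : ℝ) + y * I) := by
    have h := intervalIntegral.integral_comp_mul_left (a := φ₁) (b := φ₂)
      (fun y : ℝ => F ((r * c : ℝ) + y * I)) hr.ne'
    rw [real_smul, ofReal_inv] at h
    simp only [hpoint, h]
  rw [leftLoopIntegral, leftLoopIntegral, hhor, hhor, hver]
  ring

/-- The integrand `w ^ (-μ) * exp (t w)` of Hankel's loop integral, to which the Fox function
reduces after the Stirling approximation of the gamma ratio; here `t = log (ρ / x)`. -/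
noncomputable def powExp (μ t : ℝ) (w : ℂ) : ℂ := w ^ (-(μ : ℂ)) * exp (t * w)

lemma norm_cpow_neg_ofReal (μ : ℝ) {w : ℂ} (hw : w ≠ 0) : ‖w ^ (-(μ : ℂ))‖ = ‖w‖ ^ (-μ) := by
  simp [norm_cpow_of_ne_zero hw]

lemma norm_cpow_neg_ofReal_le {μ δ : ℝ} (hμ : 0 ≤ μ) (hδ : 0 < δ) {w : ℂ} (hw : δ ≤ ‖w‖) :
    ‖w ^ (-(μ : ℂ))‖ ≤ δ ^ (-μ) := by
  rw [norm_cpow_neg_ofReal μ (norm_pos_iff.mp (hδ.trans_le hw))]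
  exact Real.rpow_le_rpow_of_nonpos hδ hw (neg_nonpos.mpr hμ)

lemma norm_powExp_le {μ δ : ℝ} (hμ : 0 ≤ μ) (hδ : 0 < δ) (t : ℝ) {w : ℂ} (hw : δ ≤ ‖w‖) :
    ‖powExp μ t w‖ ≤ δ ^ (-μ) * Real.exp (t * w.re) := by
  rw [powExp, norm_mul, norm_exp, re_ofReal_mul]
  gcongr
  exact norm_cpow_neg_ofReal_le hμ hδ hw

lemma norm_powExp_le_exp {μ : ℝ} (hμ : 0 ≤ μ) (t : ℝ) {w : ℂ} (hw : 1 ≤ ‖w‖) :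
    ‖powExp μ t w‖ ≤ Real.exp (t * w.re) := by
  simpa using norm_powExp_le hμ one_pos t hw

lemma hasDerivAt_powExp (μ t : ℝ) {w : ℂ} (hw : w ∈ slitPlane) :
    HasDerivAt (powExp μ t) (t * powExp μ t w - μ * powExp (μ + 1) t w) w := by
  have hpow : HasDerivAt (fun w : ℂ => w ^ (-(μ : ℂ))) (-(μ : ℂ) * w ^ (-(μ : ℂ) - 1) * 1) w :=
    (hasDerivAt_id w).cpow_const hw
  have hexp : HasDerivAt (fun w : ℂ => exp (t * w)) (exp (t * w) * (t * 1)) w :=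
    ((hasDerivAt_id w).const_mul (t : ℂ)).cexp
  refine (hpow.mul hexp).congr_deriv ?_
  rw [powExp, powExp, show -((μ + 1 : ℝ) : ℂ) = -(μ : ℂ) - 1 by push_cast; ring]
  ring

lemma loopAdmissible_powExp {μ : ℝ} (hμ : 0 ≤ μ) (t : ℝ) : LoopAdmissible (powExp μ t) t where
  differentiableOn _ hw := (hasDerivAt_powExp μ t hw).differentiableAt.differentiableWithinAt
  bound δ hδ := ⟨δ ^ (-μ), fun w hw => norm_powExp_le hμ hδ t (hw.trans (abs_im_le_norm w))⟩

/-- Hankel's loop integral `(2πi)⁻¹ ∫ w ^ (-μ) e ^ w dw`; its value is `1 / Γ(μ)`, of which only the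
behaviour at `μ = 0` is needed. -/
noncomputable def hankel (μ : ℝ) : ℂ :=
  (2 * Real.pi * I)⁻¹ * leftLoopIntegral (powExp μ 1) (-1) 1 1

lemma hankel_eq_mul {μ : ℝ} (hμ : 0 ≤ μ) : hankel μ = μ * hankel (μ + 1) := by
  have hadm := loopAdmissible_powExp hμ 1
  have hadm' := (loopAdmissible_powExp (add_nonneg hμ zero_le_one) 1).const_mul μ
  have hparts := hadm.leftLoopIntegral_eq_zero_of_hasDerivAt (hadm.sub hadm') one_pos
    (fun w hw => by simpa using hasDerivAt_powExp μ 1 hw) one_pos one_pos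
  rw [hadm.leftLoopIntegral_sub hadm' one_pos one_pos one_pos, leftLoopIntegral_const_mul,
    sub_eq_zero] at hparts
  rw [hankel, hankel, hparts]
  ring

lemma hankel_zero : hankel 0 = 0 := by simpa using hankel_eq_mul le_rfl

/-- The integral of `F` along the positively oriented boundary of the square `[-1, 1] × [-1, 1]`,
used to evaluate Hankel's integral at `μ = 1` by residues. -/
noncomputable def squareIntegral (F : ℂ → ℂ) : ℂ :=
  (∫ x in (-1 : ℝ)..1, F (x + (-1 : ℝ) * I)) - (∫ x in (-1 : ℝ)..1, F (x + (1 : ℝ) * I))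
    + I * (∫ y in (-1 : ℝ)..1, F ((1 : ℝ) + y * I))
    - I * ∫ y in (-1 : ℝ)..1, F ((-1 : ℝ) + y * I)

lemma squareIntegral_eq_zero {F : ℂ → ℂ} (hF : Differentiable ℂ F) : squareIntegral F = 0 := by
  simpa [squareIntegral] using
    integral_boundary_rect_eq_zero_of_differentiableOn F ⟨-1, -1⟩ ⟨1, 1⟩ hF.differentiableOn

lemma add_mul_I_ne_zero_of_left {x : ℝ} (hx : x ≠ 0) (y : ℝ) : (x : ℂ) + y * I ≠ 0 :=
  fun h => hx (by simpa using congrArg re h)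

lemma add_mul_I_ne_zero_of_right {y : ℝ} (hy : y ≠ 0) (x : ℝ) : (x : ℂ) + y * I ≠ 0 :=
  slitPlane_ne_zero (add_mul_I_mem_slitPlane_of_ne_zero hy x)

lemma squareIntegral_add_mul_inv {F : ℂ → ℂ} (hF : Continuous F) (a : ℂ) :
    squareIntegral (fun w => F w + a * w⁻¹)
      = squareIntegral F + a * squareIntegral fun w => w⁻¹ := by
  have hedge : ∀ g : ℝ → ℂ, Continuous g → (∀ x, g x ≠ 0) →
      ∫ x in (-1 : ℝ)..1, (F (g x) + a * (g x)⁻¹)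
        = (∫ x in (-1 : ℝ)..1, F (g x)) + a * ∫ x in (-1 : ℝ)..1, (g x)⁻¹ := by
    intro g hg hg0
    rw [← intervalIntegral.integral_const_mul]
    exact intervalIntegral.integral_add ((hF.comp hg).intervalIntegrable _ _)
      (((hg.inv₀ hg0).const_smul a).intervalIntegrable _ _)
  have hone : (-1 : ℝ) ≠ 0 := by norm_num
  unfold squareIntegral
  rw [hedge _ (by fun_prop) (add_mul_I_ne_zero_of_right hone),
    hedge _ (by fun_prop) (add_mul_I_ne_zero_of_right one_ne_zero),
    hedge _ (by fun_prop) (add_mul_I_ne_zero_of_left one_ne_zero),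
    hedge _ (by fun_prop) (add_mul_I_ne_zero_of_left hone)]
  ring

lemma integral_inv_one_add_sq_neg_one_one :
    ∫ x in (-1 : ℝ)..1, 2 * I * ((1 + x ^ 2)⁻¹ : ℝ) = Real.pi * I := by
  rw [intervalIntegral.integral_const_mul, intervalIntegral.integral_ofReal,
    integral_inv_one_add_sq, Real.arctan_neg, Real.arctan_one]
  push_cast
  ring

lemma squareIntegral_inv : squareIntegral (fun w => w⁻¹) = 2 * Real.pi * I := by
  have hone : (-1 : ℝ) ≠ 0 := by norm_num
  have hint : ∀ g : ℝ → ℂ, Continuous g → (∀ x, g x ≠ 0) →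
      IntervalIntegrable (fun x => (g x)⁻¹) volume (-1) 1 := fun g hg hg0 =>
    (hg.inv₀ hg0).intervalIntegrable _ _
  have hhor : (∫ x in (-1 : ℝ)..1, ((x : ℂ) + (-1 : ℝ) * I)⁻¹)
      - (∫ x in (-1 : ℝ)..1, ((x : ℂ) + (1 : ℝ) * I)⁻¹) = Real.pi * I := by
    rw [← intervalIntegral.integral_sub
      (hint _ (by fun_prop) (add_mul_I_ne_zero_of_right hone))
      (hint _ (by fun_prop) (add_mul_I_ne_zero_of_right one_ne_zero)),
      ← integral_inv_one_add_sq_neg_one_one]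
    refine intervalIntegral.integral_congr fun x _ => ?_
    have hprod : ((x : ℂ) + (-1 : ℝ) * I) * (x + (1 : ℝ) * I) = 1 + x ^ 2 := by
      push_cast
      linear_combination -I_mul_I
    simp only [inv_sub_inv (add_mul_I_ne_zero_of_right hone x)
      (add_mul_I_ne_zero_of_right one_ne_zero x), hprod]
    push_cast
    ring
  have hver : (∫ y in (-1 : ℝ)..1, (((1 : ℝ) : ℂ) + y * I)⁻¹)
      - (∫ y in (-1 : ℝ)..1, (((-1 : ℝ) : ℂ) + y * I)⁻¹) = -I * (Real.pi * I) := by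
    rw [← intervalIntegral.integral_sub
      (hint _ (by fun_prop) (add_mul_I_ne_zero_of_left one_ne_zero))
      (hint _ (by fun_prop) (add_mul_I_ne_zero_of_left hone)),
      ← integral_inv_one_add_sq_neg_one_one, ← intervalIntegral.integral_const_mul]
    refine intervalIntegral.integral_congr fun y _ => ?_
    have hprod : (((1 : ℝ) : ℂ) + y * I) * ((-1 : ℝ) + y * I) = -(1 + y ^ 2) := by
      push_cast
      linear_combination (y : ℂ) ^ 2 * I_mul_I
    simp only [inv_sub_inv (add_mul_I_ne_zero_of_left one_ne_zero y)
      (add_mul_I_ne_zero_of_left hone y), hprod, div_neg]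
    push_cast
    linear_combination (2 * (1 + (y : ℂ) ^ 2)⁻¹) * I_mul_I
  unfold squareIntegral
  linear_combination hhor + I * hver - Real.pi * I * I_mul_I

lemma squareIntegral_congr {F G : ℂ → ℂ} (h : ∀ w ≠ 0, F w = G w) :
    squareIntegral F = squareIntegral G := by
  have hone : (-1 : ℝ) ≠ 0 := by norm_num
  simp only [squareIntegral, h _ (add_mul_I_ne_zero_of_right hone _),
    h _ (add_mul_I_ne_zero_of_right one_ne_zero _), h _ (add_mul_I_ne_zero_of_left one_ne_zero _),
    h _ (add_mul_I_ne_zero_of_left hone _)]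

lemma squareIntegral_inv_mul {f : ℂ → ℂ} (hf : Differentiable ℂ f) :
    squareIntegral (fun w => w⁻¹ * f w) = 2 * Real.pi * I * f 0 := by
  have hdslope : Differentiable ℂ (dslope f 0) :=
    differentiableOn_univ.mp ((differentiableOn_dslope univ_mem).mpr hf.differentiableOn)
  have hsplit : ∀ w ≠ 0, w⁻¹ * f w = dslope f 0 w + f 0 * w⁻¹ := fun w hw => by
    rw [dslope_of_ne _ hw, slope_def_field]
    ring
  rw [squareIntegral_congr hsplit, squareIntegral_add_mul_inv hdslope.continuous,
    squareIntegral_eq_zero hdslope, squareIntegral_inv]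
  ring

lemma powExp_one_one : powExp 1 1 = fun w => w⁻¹ * exp w := by
  funext w
  simp [powExp, cpow_neg_one]

lemma leftLoopIntegral_powExp_one_one :
    leftLoopIntegral (powExp 1 1) (-1) 1 1 = squareIntegral (powExp 1 1) := by
  have hne : ∀ w ∈ Set.Iic (-1) ×ℂ Set.uIcc (-1 : ℝ) 1, 1 ≤ ‖w‖ := fun w hw => by
    have hre : w.re ≤ -1 := hw.1
    linarith [neg_le_abs w.re, abs_re_le_norm w]
  have hstrip := integral_boundary_strip_eq_zero (F := powExp 1 1) (C := 1) one_pos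
    (fun w hw => by
      rw [powExp_one_one]
      exact ((differentiableAt_inv (norm_pos_iff.mp (one_pos.trans_le (hne w hw)))).mul
        differentiable_exp.differentiableAt).differentiableWithinAt)
    (fun w hw => (norm_powExp_le_exp zero_le_one 1 (hne w hw)).trans_eq (one_mul _).symm)
  have hadm := loopAdmissible_powExp zero_le_one 1
  have hlow := intervalIntegral.integral_Iic_sub_Iic
    (hadm.integrableOn one_pos (neg_ne_zero.mpr one_ne_zero) (-1))
    (hadm.integrableOn one_pos (neg_ne_zero.mpr one_ne_zero) 1)
  have hup := intervalIntegral.integral_Iic_sub_Iic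
    (hadm.integrableOn one_pos one_ne_zero (-1)) (hadm.integrableOn one_pos one_ne_zero 1)
  unfold leftLoopIntegral squareIntegral
  linear_combination hlow - hup + hstrip

lemma hankel_one : hankel 1 = 1 := by
  rw [hankel, leftLoopIntegral_powExp_one_one, powExp_one_one,
    squareIntegral_inv_mul differentiable_exp, exp_zero, mul_one, inv_mul_cancel₀ two_pi_I_ne_zero]

lemma one_le_norm_add_mul_I {y : ℝ} (hy : |y| = 1) (u : ℝ) : 1 ≤ ‖(u : ℂ) + y * I‖ := by
  simpa [hy] using abs_im_le_norm ((u : ℂ) + y * I)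

lemma tendsto_hankel_one_add : Tendsto (fun μ : ℝ => hankel (μ + 1)) (𝓝[≥] 0) (𝓝 1) := by
  rw [← hankel_one]
  refine Tendsto.const_mul _ ?_
  have hpos : ∀ᶠ μ : ℝ in 𝓝[≥] 0, 0 ≤ μ + 1 := by
    filter_upwards [self_mem_nhdsWithin] with μ hμ using add_nonneg hμ zero_le_one
  refine tendsto_leftLoopIntegral (C := Real.exp 1) one_pos one_pos one_pos ?_ ?_ ?_ ?_
  · filter_upwards [hpos] with μ hμ
    exact (loopAdmissible_powExp hμ 1).differentiableOn.continuousOn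
  · filter_upwards [hpos] with μ hμ u _ y hy
    refine (norm_powExp_le_exp hμ 1 (one_le_norm_add_mul_I hy u)).trans ?_
    rw [show ((u : ℂ) + y * I).re = u by simp]
    exact le_mul_of_one_le_left (Real.exp_nonneg _) (Real.one_le_exp zero_le_one)
  · filter_upwards [hpos] with μ hμ y _
    refine (norm_powExp_le_exp hμ 1 ?_).trans (by simp)
    simpa using abs_re_le_norm (((1 : ℝ) : ℂ) + y * I)
  · intro w hw
    have hcont : Continuous fun μ : ℝ => powExp (μ + 1) 1 w := by
      unfold powExp
      exact (Continuous.const_cpow (by fun_prop) (Or.inl (slitPlane_ne_zero hw))).mul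
        continuous_const
    simpa using (hcont.tendsto 0).mono_left nhdsWithin_le_nhds

lemma ofReal_mul_cpow {t : ℝ} (ht : 0 < t) (w s : ℂ) :
    ((t : ℂ) * w) ^ s = (t : ℂ) ^ s * w ^ s := by
  rcases eq_or_ne w 0 with rfl | hw
  · rcases eq_or_ne s 0 with rfl | hs
    · simp
    · simp [zero_cpow hs]
  · have htc : (t : ℂ) ≠ 0 := ofReal_ne_zero.mpr ht.ne'
    rw [cpow_def_of_ne_zero (mul_ne_zero htc hw), cpow_def_of_ne_zero htc, cpow_def_of_ne_zero hw,
      log_ofReal_mul ht hw, ← ofReal_log ht.le, ← exp_add, add_mul]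

lemma powExp_eq_mul_powExp_one (μ : ℝ) {t : ℝ} (ht : 0 < t) (w : ℂ) :
    powExp μ t w = ((t ^ μ : ℝ) : ℂ) * powExp μ 1 (t * w) := by
  rw [powExp, powExp, ofReal_mul_cpow ht, ofReal_cpow ht.le, ofReal_one, one_mul, ← mul_assoc,
    ← mul_assoc, ← cpow_add _ _ (ofReal_ne_zero.mpr ht.ne'), add_neg_cancel, cpow_zero, one_mul]

lemma leftLoopIntegral_powExp {μ t : ℝ} (ht : 0 < t) :
    (2 * Real.pi * I)⁻¹ * leftLoopIntegral (powExp μ t) (-t⁻¹) t⁻¹ t⁻¹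
      = ((t ^ (μ - 1) : ℝ) : ℂ) * hankel μ := by
  rw [funext (powExp_eq_mul_powExp_one μ ht), leftLoopIntegral_const_mul,
    leftLoopIntegral_comp_mul _ ht, mul_neg, mul_inv_cancel₀ ht.ne', Real.rpow_sub_one ht.ne',
    hankel]
  push_cast
  ring

section Parameters

variable {p q : ℕ} {A : Fin p → ℝ} {B : Fin q → ℝ}

/-- The space `ℝ^p × ℝ^q` of the shift parameters `(a, b)`. -/
abbrev Param (p q : ℕ) : Type := (Fin p → ℝ) × (Fin q → ℝ)

/-- The parameters with `a ≥ 0` and `μ ≥ 0`: a closed set that contains `paramSet p q` and its limit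
points, and on whose bounded subsets the estimates for the Fox function are uniform. -/
def closedParamSet (p q : ℕ) : Set (Param p q) :=
  {P | (∀ k, 0 ≤ P.1 k) ∧ 0 ≤ mu P.1 P.2}

lemma continuous_mu : Continuous fun P : Param p q => mu P.1 P.2 := by
  unfold mu
  fun_prop

lemma isClosed_closedParamSet : IsClosed (closedParamSet p q) := by
  have ha : IsClosed {P : Param p q | ∀ k, 0 ≤ P.1 k} := by
    simp only [Set.ofPred_forall]
    exact isClosed_iInter fun k => isClosed_le continuous_const (by fun_prop)
  exact ha.inter (isClosed_le continuous_const continuous_mu)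

lemma paramSet_subset_closedParamSet : paramSet p q ⊆ closedParamSet p q :=
  fun _ hP => ⟨hP.1, hP.2.le⟩

lemma isCompact_closedBall_inter_closedParamSet (M : ℝ) :
    IsCompact (Metric.closedBall 0 M ∩ closedParamSet p q) :=
  (isCompact_closedBall _ _).inter_right isClosed_closedParamSet

lemma nu_pos (hAB : IsDeltaNeutral A B) (a : Fin p → ℝ) (b : Fin q → ℝ) : 0 < nu A a B b := by
  rw [nu_eq_exp hAB]
  exact Real.exp_pos _

lemma continuous_nu (hAB : IsDeltaNeutral A B) :
    Continuous fun P : Param p q => nu A P.1 B P.2 := by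
  simp_rw [nu_eq_exp hAB]
  fun_prop

lemma exists_le_of_continuous {f : Param p q → ℝ} (hf : Continuous f) (M : ℝ) :
    ∃ N : ℝ, 0 ≤ N ∧ ∀ P ∈ closedParamSet p q, ‖P‖ ≤ M → f P ≤ N := by
  obtain ⟨N, hN⟩ := (isCompact_closedBall_inter_closedParamSet M).exists_bound_of_continuousOn
    hf.continuousOn
  exact ⟨max N 0, le_max_right _ _, fun P hP hPM => le_max_of_le_left
    ((le_abs_self _).trans (hN P ⟨mem_closedBall_zero_iff.mpr hPM, hP⟩))⟩

end Parameters

lemma mul_add_mem_slitPlane {α β : ℝ} (hα : 0 < α) (hβ : 0 ≤ β) {w : ℂ} (hw : w ∈ slitPlane) :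
    (α : ℂ) * w + β ∈ slitPlane := by
  rcases hw with hre | him
  · left
    simp only [add_re, re_ofReal_mul, ofReal_re]
    positivity
  · right
    simpa using ⟨hα.ne', him⟩

lemma differentiableAt_Gamma_of_mem_slitPlane {s : ℂ} (hs : s ∈ slitPlane) :
    DifferentiableAt ℂ Gamma s :=
  differentiableAt_Gamma s fun m hm => by
    rw [hm, ← ofReal_natCast, neg_ofReal_mem_slitPlane] at hs
    exact hs.not_ge m.cast_nonneg

section NormRatio

variable {p q : ℕ} {A : Fin p → ℝ} {B : Fin q → ℝ}

lemma gammaRatio_eq_mul (A a : Fin p → ℝ) (B b : Fin q → ℝ) (s : ℂ) :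
    gammaRatio A a B b s = (∏ k, Gamma (A k * s + a k)) * ∏ j, (Gamma (B j * s + b j))⁻¹ := by
  rw [gammaRatio, div_eq_mul_inv, Finset.prod_inv_distrib]

lemma continuousOn_normRatio (B : Fin q → ℝ) (hA : ∀ k, 0 < A k) :
    ContinuousOn (fun x : Param p q × ℂ => normRatio A x.1.1 B x.1.2 x.2)
      (closedParamSet p q ×ˢ slitPlane) := by
  unfold normRatio
  simp_rw [gammaRatio_eq_mul]
  refine ContinuousOn.mul (ContinuousOn.mul ?_ ?_) (by fun_prop)
  · refine continuousOn_finsetProd _ fun k _ x hx => ContinuousAt.continuousWithinAt ?_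
    exact ContinuousAt.comp (f := fun x : Param p q × ℂ => (A k : ℂ) * x.2 + (x.1.1 k : ℂ))
      (differentiableAt_Gamma_of_mem_slitPlane
        (mul_add_mem_slitPlane (hA k) (hx.1.1 k) hx.2)).continuousAt (by fun_prop)
  · exact continuousOn_finsetProd _ fun j _ =>
      (differentiable_one_div_Gamma.continuous.comp (by fun_prop)).continuousOn

lemma differentiableOn_normRatio {a : Fin p → ℝ} (B b : Fin q → ℝ) (hA : ∀ k, 0 < A k)
    (ha : ∀ k, 0 ≤ a k) : DifferentiableOn ℂ (normRatio A a B b) slitPlane := by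
  intro w hw
  refine DifferentiableAt.differentiableWithinAt ?_
  unfold normRatio
  simp_rw [gammaRatio_eq_mul]
  refine DifferentiableAt.mul (DifferentiableAt.mul ?_ ?_) (by fun_prop)
  · exact DifferentiableAt.fun_finsetProd fun k _ =>
      (differentiableAt_Gamma_of_mem_slitPlane (mul_add_mem_slitPlane (hA k) (ha k) hw)).comp w
        (f := fun w : ℂ => (A k : ℂ) * w + (a k : ℂ)) (by fun_prop)
  · exact DifferentiableAt.fun_finsetProd fun j _ => (differentiable_one_div_Gamma _).comp w
      (f := fun w : ℂ => (B j : ℂ) * w + (b j : ℂ)) (by fun_prop)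

lemma exists_normRatio_eq_of_norm_le (hAB : IsDeltaNeutral A B) {P : Param p q} {M R : ℝ}
    (hM : ‖P‖ ≤ M) (hR : 0 < R) {w : ℂ}
    (hw : R ≤ |w.im| ∨ (R ≤ w.re ∧ (∀ k, 2 * M ≤ A k * R) ∧ ∀ j, 2 * M ≤ B j * R)) :
    ∃ E : ℂ, ‖E‖ ≤ errorConst A B M / R ∧
      normRatio A P.1 B P.2 w = nu A P.1 B P.2 * w ^ (-(mu P.1 P.2 : ℂ)) * exp E :=
  exists_normRatio_eq hAB (fun k => ((norm_le_pi_norm P.1 k).trans (norm_fst_le P)).trans hM)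
    (fun j => ((norm_le_pi_norm P.2 j).trans (norm_snd_le P)).trans hM) hR hw

lemma norm_normRatio_le (hAB : IsDeltaNeutral A B) {P : Param p q} (hP : 0 ≤ mu P.1 P.2)
    {M R : ℝ} (hM : ‖P‖ ≤ M) (hR : 0 < R) {w : ℂ} (hw : R ≤ |w.im|) :
    ‖normRatio A P.1 B P.2 w‖
      ≤ nu A P.1 B P.2 * R ^ (-mu P.1 P.2) * Real.exp (errorConst A B M / R) := by
  obtain ⟨E, hE, hratio⟩ := exists_normRatio_eq_of_norm_le hAB hM hR (Or.inl hw)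
  have hν := nu_pos hAB P.1 P.2
  have hpow := norm_cpow_neg_ofReal_le hP hR (hw.trans (abs_im_le_norm w))
  have hexp : ‖exp E‖ ≤ Real.exp (errorConst A B M / R) :=
    (norm_exp_le_exp_norm E).trans (Real.exp_le_exp.mpr hE)
  rw [hratio, norm_mul, norm_mul, norm_real, Real.norm_of_nonneg hν.le]
  gcongr

/-- The Mellin-Barnes integrand in the variable `t = log (ρ / x)`. -/
noncomputable def logIntegrand (A a : Fin p → ℝ) (B b : Fin q → ℝ) (t : ℝ) (w : ℂ) : ℂ :=
  normRatio A a B b w * exp (t * w)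

lemma integrand_eq_logIntegrand (hAB : IsDeltaNeutral A B) (a : Fin p → ℝ) (b : Fin q → ℝ)
    (t : ℝ) : integrand A a B b (rho A B * Real.exp (-t)) = logIntegrand A a B b t := by
  funext w
  have hρ := rho_pos hAB
  have hx : 0 < rho A B * Real.exp (-t) := by positivity
  unfold integrand logIntegrand normRatio
  rw [cpow_def_of_ne_zero (by exact_mod_cast hx.ne'), mul_assoc, ← exp_add, ← ofReal_log hx.le,
    Real.log_mul hρ.ne' (Real.exp_ne_zero _), Real.log_exp]
  congr 2
  push_cast
  ring

lemma loopAdmissible_logIntegrand (hAB : IsDeltaNeutral A B) {P : Param p q}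
    (hP : P ∈ closedParamSet p q) (t : ℝ) : LoopAdmissible (logIntegrand A P.1 B P.2 t) t where
  differentiableOn := (differentiableOn_normRatio B P.2 hAB.pos_left hP.1).mul (by fun_prop)
  bound δ hδ := by
    refine ⟨nu A P.1 B P.2 * δ ^ (-mu P.1 P.2) * Real.exp (errorConst A B ‖P‖ / δ),
      fun w hw => ?_⟩
    rw [logIntegrand, norm_mul, norm_exp, re_ofReal_mul]
    exact mul_le_mul_of_nonneg_right (norm_normRatio_le hAB hP.2 le_rfl hδ hw)
      (Real.exp_nonneg _)

lemma abscissa_pos (hA : ∀ k, 0 < A k) (a : Fin p → ℝ) : 0 < abscissa A a :=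
  add_pos_of_pos_of_nonneg one_pos
    (Finset.sum_nonneg fun k _ => div_nonneg (abs_nonneg _) (hA k).le)

lemma foxHComplex_eq_leftLoopIntegral (hAB : IsDeltaNeutral A B) {P : Param p q}
    (hP : P ∈ closedParamSet p q) {t φ c : ℝ} (ht : 0 < t) (hφ : 0 < φ) (hc : 0 < c) :
    foxHComplex A P.1 B P.2 (rho A B * Real.exp (-t))
      = (2 * Real.pi * I)⁻¹ * leftLoopIntegral (logIntegrand A P.1 B P.2 t) (-φ) φ c := by
  rw [foxHComplex, integrand_eq_logIntegrand hAB,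
    (loopAdmissible_logIntegrand hAB hP t).leftLoopIntegral_eq ht one_pos hφ
      (abscissa_pos hAB.pos_left P.1) hc]

lemma exists_norm_normRatio_le (hAB : IsDeltaNeutral A B) (M : ℝ) :
    ∃ C : ℝ, 0 ≤ C ∧ ∀ P ∈ closedParamSet p q, ‖P‖ ≤ M →
      (∀ w : ℂ, |w.im| = 1 → ‖normRatio A P.1 B P.2 w‖ ≤ C) ∧
      ∀ y : ℝ, |y| ≤ 1 → ‖normRatio A P.1 B P.2 ((1 / 2 : ℝ) + y * I)‖ ≤ C := by
  obtain ⟨N, hN0, hN⟩ := exists_le_of_continuous (continuous_nu hAB) M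
  obtain ⟨D, hD⟩ := ((isCompact_closedBall_inter_closedParamSet M).prod
    (isCompact_Icc (a := (-1 : ℝ)) (b := 1))).exists_bound_of_continuousOn
    (f := fun x => normRatio A x.1.1 B x.1.2 ((1 / 2 : ℝ) + x.2 * I))
    ((continuousOn_normRatio B hAB.pos_left).comp
      (f := fun x : Param p q × ℝ => (x.1, (((1 / 2 : ℝ) : ℂ) + x.2 * I))) (by fun_prop)
      fun x hx => ⟨hx.1.2, add_mul_I_mem_slitPlane_of_pos (by norm_num) x.2⟩)
  refine ⟨max (N * Real.exp (errorConst A B M / 1)) D, le_max_of_le_left (by positivity),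
    fun P hP hPM => ⟨fun w hw => le_max_of_le_left ?_, fun y hy => le_max_of_le_right ?_⟩⟩
  · refine (norm_normRatio_le hAB hP.2 hPM one_pos hw.ge).trans ?_
    rw [Real.one_rpow, mul_one]
    gcongr
    exact hN P hP hPM
  · exact hD (P, y) ⟨⟨mem_closedBall_zero_iff.mpr hPM, hP⟩, abs_le.mp hy⟩

lemma exists_norm_logIntegrand_le (hAB : IsDeltaNeutral A B) (M : ℝ) :
    ∃ C : ℝ, 0 ≤ C ∧ ∀ P ∈ closedParamSet p q, ‖P‖ ≤ M → ∀ t : ℝ,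
      (∀ u y : ℝ, |y| = 1 → ‖logIntegrand A P.1 B P.2 t (u + y * I)‖ ≤ C * Real.exp (t * u)) ∧
      ∀ y : ℝ, |y| ≤ 1 →
        ‖logIntegrand A P.1 B P.2 t ((1 / 2 : ℝ) + y * I)‖ ≤ C * Real.exp (t / 2) := by
  obtain ⟨C, hC0, hC⟩ := exists_norm_normRatio_le hAB M
  refine ⟨C, hC0, fun P hP hPM t => ⟨fun u y hy => ?_, fun y hy => ?_⟩⟩
  · have hhor := (hC P hP hPM).1 (u + y * I) (by simpa using hy)
    rw [logIntegrand, norm_mul, norm_exp, re_ofReal_mul]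
    simpa using mul_le_mul_of_nonneg_right hhor (Real.exp_nonneg (t * (u + y * I : ℂ).re))
  · have hver := (hC P hP hPM).2 y hy
    have hre : t * (((1 / 2 : ℝ) : ℂ) + y * I).re = t / 2 := by
      simp
      ring
    rw [logIntegrand, norm_mul, norm_exp, re_ofReal_mul, hre]
    exact mul_le_mul_of_nonneg_right hver (Real.exp_nonneg _)

end NormRatio

lemma norm_two_pi_I_inv_le : ‖(2 * Real.pi * I : ℂ)⁻¹‖ ≤ 1 := by
  rw [norm_inv]
  refine inv_le_one_of_one_le₀ ?_
  simp only [norm_mul, norm_ofNat, norm_real, norm_I, mul_one, Real.norm_of_nonneg Real.pi_pos.le]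
  linarith [Real.pi_gt_three]

section Estimates

variable {p q : ℕ} {A : Fin p → ℝ} {B : Fin q → ℝ}

lemma exists_norm_foxHComplex_le (hAB : IsDeltaNeutral A B) (M : ℝ) :
    ∃ C : ℝ, 0 ≤ C ∧ ∀ P ∈ closedParamSet p q, ‖P‖ ≤ M → ∀ t : ℝ, 0 < t →
      ‖foxHComplex A P.1 B P.2 (rho A B * Real.exp (-t))‖
        ≤ C * (1 / t + 1) * Real.exp (t / 2) := by
  obtain ⟨C, hC0, hC⟩ := exists_norm_logIntegrand_le hAB M
  refine ⟨2 * C, by positivity, fun P hP hPM t ht => ?_⟩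
  obtain ⟨hhor, hver⟩ := hC P hP hPM t
  rw [foxHComplex_eq_leftLoopIntegral hAB hP ht one_pos (c := 1 / 2) (by norm_num), norm_mul]
  refine (mul_le_of_le_one_left (norm_nonneg _) norm_two_pi_I_inv_le).trans
    ((norm_leftLoopIntegral_le ht one_pos (fun u _ => hhor u) hver).trans_eq ?_)
  rw [mul_one_div t]
  field_simp

lemma exists_threshold (hAB : IsDeltaNeutral A B) (M : ℝ) :
    ∃ R₀ : ℝ, 1 ≤ R₀ ∧ ∀ R, R₀ ≤ R → (∀ k, 2 * M ≤ A k * R) ∧ ∀ j, 2 * M ≤ B j * R := by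
  have hlarge : ∀ α : ℝ, 0 < α → ∀ᶠ R : ℝ in atTop, 2 * M ≤ α * R := fun α hα =>
    (tendsto_id.const_mul_atTop hα).eventually_ge_atTop _
  obtain ⟨R₀, hR₀⟩ := eventually_atTop.mp
    ((eventually_all.mpr fun k => hlarge (A k) (hAB.pos_left k)).and
      (eventually_all.mpr fun j => hlarge (B j) (hAB.pos_right j)))
  exact ⟨max 1 R₀, le_max_left _ _, fun R hR => hR₀ R ((le_max_right _ _).trans hR)⟩

lemma norm_exp_sub_one_le_mul_exp (z : ℂ) : ‖exp z - 1‖ ≤ ‖z‖ * Real.exp ‖z‖ := by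
  simpa using norm_exp_sub_sum_le_norm_mul_exp z 1

lemma norm_logIntegrand_sub_le (hAB : IsDeltaNeutral A B) {P : Param p q}
    (hP : 0 ≤ mu P.1 P.2) {M t : ℝ} (hM : ‖P‖ ≤ M) (ht : 0 < t) (ht1 : t ≤ 1)
    (hA : ∀ k, 2 * M ≤ A k * t⁻¹) (hB : ∀ j, 2 * M ≤ B j * t⁻¹) {w : ℂ}
    (hw : w ∈ farRegion t⁻¹) :
    ‖logIntegrand A P.1 B P.2 t w - nu A P.1 B P.2 * powExp (mu P.1 P.2) t w‖
      ≤ nu A P.1 B P.2 * (errorConst A B M * Real.exp (errorConst A B M)) * t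
        * Real.exp (t * w.re) := by
  obtain ⟨E, hE, hratio⟩ := exists_normRatio_eq_of_norm_le hAB hM (inv_pos.mpr ht) (w := w)
    (hw.symm.imp_right fun h => ⟨h, hA, hB⟩)
  rw [div_inv_eq_mul] at hE
  have hK := errorConst_nonneg hAB ((norm_nonneg P).trans hM)
  have hexp : ‖exp E - 1‖ ≤ errorConst A B M * t * Real.exp (errorConst A B M) := by
    refine (norm_exp_sub_one_le_mul_exp E).trans ?_
    gcongr
    exact hE.trans (mul_le_of_le_one_right hK ht1)
  have hmain := norm_powExp_le_exp hP t
    (((one_le_inv₀ ht).mpr ht1).trans (le_norm_of_mem_farRegion hw))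
  have hν := nu_pos hAB P.1 P.2
  have hsplit : logIntegrand A P.1 B P.2 t w - nu A P.1 B P.2 * powExp (mu P.1 P.2) t w
      = nu A P.1 B P.2 * powExp (mu P.1 P.2) t w * (exp E - 1) := by
    rw [logIntegrand, hratio, powExp]
    ring
  rw [hsplit, norm_mul, norm_mul, norm_real, Real.norm_of_nonneg hν.le]
  calc nu A P.1 B P.2 * ‖powExp (mu P.1 P.2) t w‖ * ‖exp E - 1‖
      ≤ nu A P.1 B P.2 * Real.exp (t * w.re)
        * (errorConst A B M * t * Real.exp (errorConst A B M)) := by gcongr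
    _ = _ := by ring

lemma foxHComplex_sub_eq_leftLoopIntegral (hAB : IsDeltaNeutral A B) {P : Param p q}
    (hP : P ∈ closedParamSet p q) {t : ℝ} (ht : 0 < t) :
    foxHComplex A P.1 B P.2 (rho A B * Real.exp (-t))
        - nu A P.1 B P.2 * (t ^ (mu P.1 P.2 - 1) : ℝ) * hankel (mu P.1 P.2)
      = (2 * Real.pi * I)⁻¹ * leftLoopIntegral (fun w => logIntegrand A P.1 B P.2 t w
          - nu A P.1 B P.2 * powExp (mu P.1 P.2) t w) (-t⁻¹) t⁻¹ t⁻¹ := by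
  have hR := inv_pos.mpr ht
  rw [(loopAdmissible_logIntegrand hAB hP t).leftLoopIntegral_sub
    ((loopAdmissible_powExp hP.2 t).const_mul _) ht hR hR, leftLoopIntegral_const_mul,
    foxHComplex_eq_leftLoopIntegral hAB hP ht hR hR]
  linear_combination (nu A P.1 B P.2 : ℂ) * leftLoopIntegral_powExp (μ := mu P.1 P.2) ht

-- The loop with corners `t⁻¹ (1 ± i)` stays where Stirling's formula has a relative error `O(t)`.
lemma exists_norm_foxHComplex_sub_le (hAB : IsDeltaNeutral A B) {M : ℝ} (hM : 0 ≤ M) :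
    ∃ C T : ℝ, 0 ≤ C ∧ 0 < T ∧ ∀ P ∈ closedParamSet p q, ‖P‖ ≤ M → ∀ t : ℝ, 0 < t → t ≤ T →
      ‖foxHComplex A P.1 B P.2 (rho A B * Real.exp (-t))
        - nu A P.1 B P.2 * (t ^ (mu P.1 P.2 - 1) : ℝ) * hankel (mu P.1 P.2)‖ ≤ C := by
  obtain ⟨N, hN0, hN⟩ := exists_le_of_continuous (continuous_nu hAB) M
  obtain ⟨R₀, hR₀, hR⟩ := exists_threshold hAB M
  have hK := errorConst_nonneg hAB hM
  set D := N * (errorConst A B M * Real.exp (errorConst A B M)) with hD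
  refine ⟨4 * D * Real.exp 1, R₀⁻¹, by positivity, by positivity, fun P hP hPM t ht htT => ?_⟩
  obtain ⟨hA, hB⟩ := hR t⁻¹ ((le_inv_comm₀ ht (by positivity)).mp htT)
  have hfar : ∀ w ∈ farRegion t⁻¹, ‖logIntegrand A P.1 B P.2 t w
      - nu A P.1 B P.2 * powExp (mu P.1 P.2) t w‖ ≤ D * t * Real.exp (t * w.re) := by
    intro w hw
    refine (norm_logIntegrand_sub_le hAB hP.2 hPM ht (htT.trans (inv_le_one_of_one_le₀ hR₀))
      hA hB hw).trans ?_
    rw [hD]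
    gcongr
    exact hN P hP hPM
  rw [foxHComplex_sub_eq_leftLoopIntegral hAB hP ht, norm_mul]
  refine (mul_le_of_le_one_left (norm_nonneg _) norm_two_pi_I_inv_le).trans
    ((norm_leftLoopIntegral_le (C := D * t) (C' := D * t * Real.exp 1) ht (inv_pos.mpr ht)
      (fun u _ y hy => ?_) fun y _ => ?_).trans_eq ?_)
  · simpa using hfar (u + y * I) (Or.inr (by simp [hy]))
  · simpa [ht.ne'] using hfar ((t⁻¹ : ℝ) + y * I) (Or.inl (by simp))
  · rw [mul_inv_cancel₀ ht.ne']
    field_simp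
    ring

end Estimates

lemma norm_hankel_le {μ : ℝ} (hμ : 0 ≤ μ) : ‖hankel μ‖ ≤ 4 * Real.exp 1 := by
  rw [hankel, norm_mul]
  refine (mul_le_of_le_one_left (norm_nonneg _) norm_two_pi_I_inv_le).trans
    ((norm_leftLoopIntegral_le (C := 1) (C' := Real.exp 1) one_pos one_pos
      (fun u _ y hy => ?_) fun y _ => ?_).trans_eq ?_)
  · simpa using norm_powExp_le_exp hμ 1 (one_le_norm_add_mul_I hy u)
  · simpa using norm_powExp_le_exp hμ 1
      (show 1 ≤ ‖((1 : ℝ) : ℂ) + y * I‖ by simpa using abs_re_le_norm (((1 : ℝ) : ℂ) + y * I))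
  · ring_nf

lemma exists_rpow_le_exp (m : ℝ) :
    ∃ C : ℝ, 0 ≤ C ∧ ∀ μ t : ℝ, 0 ≤ μ → μ ≤ m → 0 < t → t ^ μ ≤ C * Real.exp (t / 2) := by
  obtain ⟨n, hn⟩ := exists_nat_ge m
  refine ⟨1 + 2 ^ n * n.factorial, by positivity, fun μ t hμ hμm ht => ?_⟩
  have hone : 1 ≤ Real.exp (t / 2) := Real.one_le_exp (by positivity)
  have hpow : t ^ n ≤ 2 ^ n * n.factorial * Real.exp (t / 2) := by
    have hfact := Real.pow_div_factorial_le_exp (t / 2) (by positivity) n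
    rw [div_le_iff₀ (by positivity), div_pow, div_le_iff₀ (by positivity)] at hfact
    linarith
  have hmax : t ^ μ ≤ 1 + t ^ n := by
    rcases le_total t 1 with ht1 | ht1
    · exact (Real.rpow_le_one ht.le ht1 hμ).trans (le_add_of_nonneg_right (by positivity))
    · rw [← Real.rpow_natCast]
      exact (Real.rpow_le_rpow_of_exponent_le ht1 (hμm.trans hn)).trans
        (le_add_of_nonneg_left zero_le_one)
  linarith

section UniformBounds

variable {p q : ℕ} {A : Fin p → ℝ} {B : Fin q → ℝ}

/-- The Fox function in the variable `t = log (ρ / x)`, in which the endpoint `x = ρ` is `t = 0`. -/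
noncomputable def logFox (A : Fin p → ℝ) (B : Fin q → ℝ) (P : Param p q) (t : ℝ) : ℝ :=
  foxH A P.1 B P.2 (rho A B * Real.exp (-t))

/-- The leading term of `logFox` at `t = 0`. Since `hankel μ` is `1 / Γ(μ)`, it is
`ν * t ^ (μ - 1) / Γ(μ)`. -/
noncomputable def mainTerm (A : Fin p → ℝ) (B : Fin q → ℝ) (P : Param p q) (t : ℝ) : ℝ :=
  nu A P.1 B P.2 * t ^ (mu P.1 P.2 - 1) * (hankel (mu P.1 P.2)).re

lemma exists_abs_logFox_le (hAB : IsDeltaNeutral A B) (M : ℝ) :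
    ∃ C : ℝ, 0 ≤ C ∧ ∀ P ∈ closedParamSet p q, ‖P‖ ≤ M → ∀ t : ℝ, 0 < t →
      |logFox A B P t| ≤ C * (1 / t + 1) * Real.exp (t / 2) := by
  obtain ⟨C, hC0, hC⟩ := exists_norm_foxHComplex_le hAB M
  exact ⟨C, hC0, fun P hP hPM t ht => (abs_re_le_norm _).trans (hC P hP hPM t ht)⟩

lemma exists_abs_mainTerm_le (hAB : IsDeltaNeutral A B) (M : ℝ) :
    ∃ C : ℝ, 0 ≤ C ∧ ∀ P ∈ closedParamSet p q, ‖P‖ ≤ M → ∀ t : ℝ, 0 < t →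
      |mainTerm A B P t| ≤ C * (1 / t) * Real.exp (t / 2) := by
  obtain ⟨N, hN0, hN⟩ := exists_le_of_continuous (continuous_nu hAB) M
  obtain ⟨m, -, hm⟩ := exists_le_of_continuous (p := p) (q := q) continuous_mu M
  obtain ⟨C, hC0, hC⟩ := exists_rpow_le_exp m
  refine ⟨N * C * (4 * Real.exp 1), by positivity, fun P hP hPM t ht => ?_⟩
  have hν := nu_pos hAB P.1 P.2
  have hhankel := (abs_re_le_norm _).trans (norm_hankel_le hP.2)
  rw [mainTerm, abs_mul, abs_mul, abs_of_pos hν, abs_of_pos (by positivity),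
    Real.rpow_sub_one ht.ne']
  calc _ ≤ N * (C * Real.exp (t / 2) / t) * (4 * Real.exp 1) := by
        gcongr
        exacts [hN P hP hPM, hC _ t hP.2 (hm P hP hPM) ht]
    _ = _ := by ring

lemma exists_abs_logFox_sub_mainTerm_le_of_le (hAB : IsDeltaNeutral A B) {M : ℝ} (hM : 0 ≤ M) :
    ∃ C T : ℝ, 0 ≤ C ∧ 0 < T ∧ ∀ P ∈ closedParamSet p q, ‖P‖ ≤ M → ∀ t : ℝ, 0 < t → t ≤ T →
      |logFox A B P t - mainTerm A B P t| ≤ C := by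
  obtain ⟨C, T, hC0, hT, hC⟩ := exists_norm_foxHComplex_sub_le hAB hM
  refine ⟨C, T, hC0, hT, fun P hP hPM t ht htT => ?_⟩
  have h := (abs_re_le_norm _).trans (hC P hP hPM t ht htT)
  rwa [sub_re, ← ofReal_mul, re_ofReal_mul] at h

theorem exists_abs_logFox_sub_mainTerm_le (hAB : IsDeltaNeutral A B) {M : ℝ} (hM : 0 ≤ M) :
    ∃ C : ℝ, ∀ P ∈ closedParamSet p q, ‖P‖ ≤ M → ∀ t : ℝ, 0 < t →
      |logFox A B P t - mainTerm A B P t| ≤ C * Real.exp (t / 2) := by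
  obtain ⟨C₀, T, hC₀, hT, hnear⟩ := exists_abs_logFox_sub_mainTerm_le_of_le hAB hM
  obtain ⟨C₁, hC₁, hfox⟩ := exists_abs_logFox_le hAB M
  obtain ⟨C₂, hC₂, hmain⟩ := exists_abs_mainTerm_le hAB M
  refine ⟨C₀ + (C₁ * (1 / T + 1) + C₂ * (1 / T)), fun P hP hPM t ht => ?_⟩
  rw [add_mul]
  rcases le_total t T with htT | htT
  · refine (hnear P hP hPM t ht htT).trans (le_add_of_le_of_nonneg
      (le_mul_of_one_le_right hC₀ (Real.one_le_exp (by positivity))) (by positivity))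
  · refine ((abs_sub _ _).trans (add_le_add (hfox P hP hPM t ht) (hmain P hP hPM t ht))).trans
      (le_add_of_nonneg_of_le (by positivity) ?_)
    rw [← add_mul]
    gcongr

lemma eventually_near {P₀ : Param p q} {t₀ : ℝ} (ht₀ : 0 < t₀) :
    ∀ᶠ x : Param p q × ℝ in 𝓝[closedParamSet p q ×ˢ Set.Ioi 0] (P₀, t₀),
      x.1 ∈ closedParamSet p q ∧ ‖x.1‖ ≤ ‖P₀‖ + 1 ∧ t₀ / 2 < x.2 ∧ x.2 < 2 * t₀ := by
  have hnorm : ∀ᶠ x : Param p q × ℝ in 𝓝 (P₀, t₀), ‖x.1‖ < ‖P₀‖ + 1 :=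
    continuous_fst.norm.continuousAt.eventually_lt_const (lt_add_one _)
  have hlow : ∀ᶠ x : Param p q × ℝ in 𝓝 (P₀, t₀), t₀ / 2 < x.2 :=
    continuousAt_snd.eventually_const_lt (half_lt_self ht₀)
  have hup : ∀ᶠ x : Param p q × ℝ in 𝓝 (P₀, t₀), x.2 < 2 * t₀ :=
    continuousAt_snd.eventually_lt_const (lt_two_mul_self ht₀)
  filter_upwards [self_mem_nhdsWithin, nhdsWithin_le_nhds hnorm, nhdsWithin_le_nhds hlow,
    nhdsWithin_le_nhds hup] with x hx hnorm hlow hup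
  exact ⟨hx.1, hnorm.le, hlow, hup⟩

lemma continuousOn_logIntegrand (B : Fin q → ℝ) (hA : ∀ k, 0 < A k) {w : ℂ}
    (hw : w ∈ slitPlane) :
    ContinuousOn (fun x : Param p q × ℝ => logIntegrand A x.1.1 B x.1.2 x.2 w)
      (closedParamSet p q ×ˢ Set.Ioi 0) :=
  ((continuousOn_normRatio B hA).comp (t := closedParamSet p q ×ˢ slitPlane)
    (f := fun x : Param p q × ℝ => (x.1, w)) (by fun_prop) fun _ hx => ⟨hx.1, hw⟩).mul
    (by fun_prop)

lemma continuousOn_leftLoopIntegral_logIntegrand (hAB : IsDeltaNeutral A B) :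
    ContinuousOn (fun x : Param p q × ℝ =>
      leftLoopIntegral (logIntegrand A x.1.1 B x.1.2 x.2) (-1) 1 (1 / 2))
      (closedParamSet p q ×ˢ Set.Ioi 0) := by
  rintro ⟨P₀, t₀⟩ ⟨hP₀, ht₀ : 0 < t₀⟩
  obtain ⟨C, hC0, hC⟩ := exists_norm_logIntegrand_le hAB (‖P₀‖ + 1)
  refine tendsto_leftLoopIntegral (t := t₀ / 2) (C := C * Real.exp t₀) (half_pos ht₀) one_pos
    (by norm_num) ?_ ?_ ?_ fun w hw => continuousOn_logIntegrand B hAB.pos_left hw _ ⟨hP₀, ht₀⟩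
  · filter_upwards [eventually_near ht₀] with x hx
    exact (loopAdmissible_logIntegrand hAB hx.1 x.2).differentiableOn.continuousOn
  · filter_upwards [eventually_near ht₀] with x ⟨hmem, hnorm, hlow, hup⟩ u hu y hy
    refine ((hC x.1 hmem hnorm x.2).1 u y hy).trans ?_
    rw [mul_assoc, ← Real.exp_add]
    gcongr
    nlinarith
  · filter_upwards [eventually_near ht₀] with x ⟨hmem, hnorm, _, hup⟩ y hy
    refine ((hC x.1 hmem hnorm x.2).2 y hy).trans ?_
    gcongr
    linarith

lemma continuousOn_logFox (hAB : IsDeltaNeutral A B) :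
    ContinuousOn (fun x : Param p q × ℝ => logFox A B x.1 x.2)
      (closedParamSet p q ×ˢ Set.Ioi 0) :=
  continuous_re.comp_continuousOn (((continuousOn_leftLoopIntegral_logIntegrand hAB).const_mul
    (2 * Real.pi * I)⁻¹).congr fun _ hx =>
      foxHComplex_eq_leftLoopIntegral hAB hx.1 hx.2 one_pos (by norm_num))

end UniformBounds

lemma tendstoUniformlyOn_mul_rpow_sub_one {δ : ℝ} (hδ : 0 < δ) :
    TendstoUniformlyOn (fun μ t : ℝ => μ * t ^ (μ - 1)) 0 (𝓝[>] 0) (Set.Ici δ) := by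
  rw [Metric.tendstoUniformlyOn_iff]
  intro ε hε
  set d := min δ 1
  have hd : 0 < d := lt_min hδ one_pos
  have hsmall : ∀ᶠ μ : ℝ in 𝓝[>] 0, μ < ε * d :=
    nhdsWithin_le_nhds (eventually_lt_nhds (by positivity))
  have hlt1 : ∀ᶠ μ : ℝ in 𝓝[>] 0, μ < 1 := nhdsWithin_le_nhds (eventually_lt_nhds one_pos)
  filter_upwards [self_mem_nhdsWithin, hsmall, hlt1] with μ (hμ : 0 < μ) hμε hμ1 t (ht : δ ≤ t)
  have ht0 : 0 < t := hδ.trans_le ht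
  have hpow : t ^ (μ - 1) ≤ d⁻¹ := by
    rw [← Real.rpow_neg_one]
    exact (Real.rpow_le_rpow_of_nonpos hd ((min_le_left _ _).trans ht) (by linarith)).trans
      (Real.rpow_le_rpow_of_exponent_ge hd (min_le_right _ _) (by linarith))
  rw [Pi.zero_apply, dist_zero_left, Real.norm_of_nonneg (by positivity)]
  calc μ * t ^ (μ - 1) ≤ μ * d⁻¹ := by gcongr
    _ < ε * d * d⁻¹ := by gcongr
    _ = ε := by field_simp

lemma tendsto_integral_mul_rpow_sub_one {g : ℝ → ℝ} {c : ℝ} (hg : IntegrableOn g (Set.Ioi 0))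
    (hlim : Tendsto g (𝓝[>] 0) (𝓝 c)) :
    Tendsto (fun μ : ℝ => ∫ t in Set.Ioi 0, μ * t ^ (μ - 1) * g t) (𝓝[>] 0) (𝓝 c) := by
  have hpos : ∀ᶠ μ : ℝ in 𝓝[>] 0, 0 < μ := self_mem_nhdsWithin
  refine tendsto_setIntegral_peak_smul_of_integrableOn_of_tendsto (x₀ := (0 : ℝ))
    (φ := fun μ t : ℝ => μ * t ^ (μ - 1)) measurableSet_Ioi (t := Set.Ioc 0 1) measurableSet_Ioc
    Set.Ioc_subset_Ioi_self (Ioc_mem_nhdsGT one_pos) (by simp) ?_ ?_ ?_ ?_ hg hlim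
  · filter_upwards [hpos] with μ hμ t (ht : 0 < t)
    positivity
  · intro u hu h0
    obtain ⟨δ, hδ, hδu⟩ := Metric.isOpen_iff.mp hu 0 h0
    refine (tendstoUniformlyOn_mul_rpow_sub_one hδ).mono fun t ht => ?_
    have ht0 : 0 < t := ht.1
    by_contra! h
    exact ht.2 (hδu (by simpa [abs_of_pos ht0] using h))
  · refine tendsto_const_nhds.congr' ?_
    filter_upwards [hpos] with μ hμ
    rw [← intervalIntegral.integral_of_le zero_le_one, intervalIntegral.integral_const_mul,
      integral_rpow (Or.inl (by linarith))]
    simp [hμ.ne']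
  · exact Eventually.of_forall fun μ =>
      (by fun_prop : Measurable fun t : ℝ => μ * t ^ (μ - 1)).aestronglyMeasurable

section ExpPullback

variable {r η : ℝ} {f : ℝ → ℝ}

/-- The density in `t` of `f x dx` under the substitution `x = r * exp (-t)`, which turns `[0, r]`
into the half-line and the endpoint `r` into `t = 0`. -/
noncomputable def expPullback (r : ℝ) (f : ℝ → ℝ) (t : ℝ) : ℝ :=
  r * Real.exp (-t) * f (r * Real.exp (-t))

lemma image_mul_exp_neg_Ioi (hr : 0 < r) :
    (fun t : ℝ => r * Real.exp (-t)) '' Set.Ioi 0 = Set.Ioo 0 r := by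
  ext x
  constructor
  · rintro ⟨t, ht, rfl⟩
    exact ⟨by positivity, mul_lt_of_lt_one_right hr (Real.exp_lt_one_iff.mpr (neg_lt_zero.mpr ht))⟩
  · rintro ⟨hx0, hxr⟩
    refine ⟨Real.log (r / x), Real.log_pos ((one_lt_div hx0).mpr hxr), ?_⟩
    simp only [Real.exp_neg, Real.exp_log (div_pos hr hx0)]
    field_simp

lemma hasDerivAt_mul_exp_neg (r t : ℝ) :
    HasDerivAt (fun t : ℝ => r * Real.exp (-t)) (-(r * Real.exp (-t))) t := by
  simpa using ((hasDerivAt_neg t).exp).const_mul r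

lemma injective_mul_exp_neg (hr : 0 < r) : Function.Injective fun t : ℝ => r * Real.exp (-t) :=
  (mul_right_injective₀ hr.ne').comp (Real.exp_injective.comp neg_injective)

lemma abs_deriv_smul_eq_expPullback (hr : 0 < r) (f : ℝ → ℝ) :
    (fun t => |-(r * Real.exp (-t))| • f (r * Real.exp (-t))) = expPullback r f := by
  funext t
  rw [abs_neg, abs_of_pos (by positivity), smul_eq_mul, expPullback]

lemma integrableOn_Icc_iff_expPullback (hr : 0 < r) :
    IntegrableOn f (Set.Icc 0 r) ↔ IntegrableOn (expPullback r f) (Set.Ioi 0) := by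
  rw [integrableOn_Icc_iff_integrableOn_Ioo, ← image_mul_exp_neg_Ioi hr,
    integrableOn_image_iff_integrableOn_abs_deriv_smul measurableSet_Ioi
      (fun t _ => (hasDerivAt_mul_exp_neg r t).hasDerivWithinAt) (injective_mul_exp_neg hr).injOn,
    abs_deriv_smul_eq_expPullback hr]

lemma setIntegral_Icc_eq_expPullback (hr : 0 < r) (f : ℝ → ℝ) :
    ∫ x in Set.Icc 0 r, f x = ∫ t in Set.Ioi 0, expPullback r f t := by
  rw [integral_Icc_eq_integral_Ioo, ← image_mul_exp_neg_Ioi hr,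
    integral_image_eq_integral_abs_deriv_smul measurableSet_Ioi
      (fun t _ => (hasDerivAt_mul_exp_neg r t).hasDerivWithinAt) (injective_mul_exp_neg hr).injOn,
    abs_deriv_smul_eq_expPullback hr]

lemma setIntegral_mul_eq_expPullback (hr : 0 < r) (hη : 0 ≤ η) (f h : ℝ → ℝ) :
    ∫ x in Set.Icc η r, f x * h x
      = ∫ t in Set.Ioi 0, expPullback r ((Set.Icc η r).indicator f) t * h (r * Real.exp (-t)) := by
  calc ∫ x in Set.Icc η r, f x * h x
      = ∫ x in Set.Icc 0 r, (Set.Icc η r).indicator (fun x => f x * h x) x := by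
        rw [setIntegral_indicator measurableSet_Icc,
          Set.inter_eq_self_of_subset_right (Set.Icc_subset_Icc_left hη)]
    _ = _ := by
        rw [setIntegral_Icc_eq_expPullback hr]
        simp only [expPullback, Set.indicator_mul_left, mul_assoc]

lemma measurable_expPullback_indicator (hf : ContinuousOn f (Set.Icc η r)) :
    Measurable (expPullback r ((Set.Icc η r).indicator f)) := by
  classical
  have hind : Measurable ((Set.Icc η r).indicator f) := by
    rw [← Set.piecewise_eq_indicator]
    exact hf.measurable_piecewise continuousOn_const measurableSet_Icc
  exact (by fun_prop : Measurable fun t : ℝ => r * Real.exp (-t)).mul (hind.comp (by fun_prop))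

lemma exists_abs_expPullback_indicator_le (hr : 0 < r) (hf : ContinuousOn f (Set.Icc η r)) :
    ∃ D : ℝ, ∀ t, |expPullback r ((Set.Icc η r).indicator f) t| ≤ D * Real.exp (-t) := by
  obtain ⟨D, hD⟩ := isCompact_Icc.exists_bound_of_continuousOn hf
  refine ⟨r * |D|, fun t => ?_⟩
  have hind : |(Set.Icc η r).indicator f (r * Real.exp (-t))| ≤ |D| := by
    by_cases hx : r * Real.exp (-t) ∈ Set.Icc η r
    · rw [Set.indicator_of_mem hx]
      exact (hD _ hx).trans (le_abs_self D)
    · rw [Set.indicator_of_notMem hx, abs_zero]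
      exact abs_nonneg D
  rw [expPullback, abs_mul, abs_of_pos (by positivity), mul_right_comm]
  gcongr

lemma tendsto_mul_exp_neg_nhdsGT_zero (hr : 0 < r) (hη : η < r) :
    Tendsto (fun t : ℝ => r * Real.exp (-t)) (𝓝[>] 0) (𝓝[Set.Icc η r] r) := by
  have hlim : Tendsto (fun t : ℝ => r * Real.exp (-t)) (𝓝[>] 0) (𝓝 r) := by
    have hcont : Continuous fun t : ℝ => r * Real.exp (-t) := by fun_prop
    simpa using (hcont.tendsto 0).mono_left nhdsWithin_le_nhds
  refine tendsto_nhdsWithin_iff.mpr ⟨hlim, ?_⟩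
  filter_upwards [hlim.eventually_const_lt hη, self_mem_nhdsWithin] with t ht (ht0 : 0 < t)
  exact ⟨ht.le, mul_le_of_le_one_right hr.le (Real.exp_le_one_iff.mpr (neg_nonpos.mpr ht0.le))⟩

lemma tendsto_expPullback_indicator (hr : 0 < r) (hη : η < r)
    (hf : ContinuousOn f (Set.Icc η r)) :
    Tendsto (expPullback r ((Set.Icc η r).indicator f)) (𝓝[>] 0) (𝓝 (r * f r)) := by
  have hlim := tendsto_mul_exp_neg_nhdsGT_zero hr hη
  refine ((hlim.mono_right nhdsWithin_le_nhds).mul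
    ((hf r ⟨hη.le, le_rfl⟩).tendsto.comp hlim)).congr' ?_
  filter_upwards [(tendsto_nhdsWithin_iff.mp hlim).2] with t ht
  rw [expPullback, Set.indicator_of_mem ht, Function.comp_apply]

end ExpPullback

lemma exp_neg_mul_exp_half (t : ℝ) : Real.exp (-t) * Real.exp (t / 2) = Real.exp (-1 / 2 * t) := by
  rw [← Real.exp_add]
  ring_nf

section Limit

variable {p q : ℕ} {A : Fin p → ℝ} {B : Fin q → ℝ} {P P₀ : Param p q}

lemma hankel_re_eq_mul {μ : ℝ} (hμ : 0 ≤ μ) : (hankel μ).re = μ * (hankel (μ + 1)).re := by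
  rw [hankel_eq_mul hμ, re_ofReal_mul]

lemma mainTerm_eq_zero (hP : mu P.1 P.2 = 0) (t : ℝ) : mainTerm A B P t = 0 := by
  simp [mainTerm, hP, hankel_zero]

lemma measurable_mainTerm (P : Param p q) : Measurable (mainTerm A B P) := by
  unfold mainTerm
  fun_prop

lemma aestronglyMeasurable_logFox (hAB : IsDeltaNeutral A B) (hP : P ∈ closedParamSet p q) :
    AEStronglyMeasurable (logFox A B P) (volume.restrict (Set.Ioi 0)) :=
  ContinuousOn.aestronglyMeasurable ((continuousOn_logFox hAB).comp
    (f := fun t : ℝ => (P, t)) (by fun_prop) fun _ ht => ⟨hP, ht⟩) measurableSet_Ioi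

lemma aestronglyMeasurable_logFox_sub_mainTerm (hAB : IsDeltaNeutral A B)
    (hP : P ∈ closedParamSet p q) :
    AEStronglyMeasurable (fun t => logFox A B P t - mainTerm A B P t)
      (volume.restrict (Set.Ioi 0)) :=
  (aestronglyMeasurable_logFox hAB hP).sub (measurable_mainTerm P).aestronglyMeasurable

lemma integrableOn_exp_neg_mul_sub_mainTerm (hAB : IsDeltaNeutral A B)
    (hP : P ∈ closedParamSet p q) :
    IntegrableOn (fun t => Real.exp (-t) * (logFox A B P t - mainTerm A B P t)) (Set.Ioi 0) := by
  obtain ⟨C, hC⟩ := exists_abs_logFox_sub_mainTerm_le hAB (norm_nonneg P)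
  refine Integrable.mono' ((integrableOn_exp_mul_Ioi (a := -1 / 2) (by norm_num) 0).const_mul C)
    ((by fun_prop : Measurable fun t : ℝ => Real.exp (-t)).aestronglyMeasurable.mul
      (aestronglyMeasurable_logFox_sub_mainTerm hAB hP)) ?_
  filter_upwards [ae_restrict_mem measurableSet_Ioi] with t ht
  rw [norm_mul, Real.norm_of_nonneg (Real.exp_nonneg _), ← exp_neg_mul_exp_half, mul_left_comm]
  gcongr
  exact hC P hP le_rfl t ht

lemma integrableOn_exp_neg_mul_mainTerm (hP : 0 ≤ mu P.1 P.2) :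
    IntegrableOn (fun t => Real.exp (-t) * mainTerm A B P t) (Set.Ioi 0) := by
  rcases hP.eq_or_lt with hμ | hμ
  · simp [mainTerm_eq_zero hμ.symm]
  · refine ((Real.GammaIntegral_convergent hμ).const_mul
      (nu A P.1 B P.2 * (hankel (mu P.1 P.2)).re)).congr (Eventually.of_forall fun t => ?_)
    simp only [mainTerm]
    ring

theorem integrableOn_foxH (hAB : IsDeltaNeutral A B) (hP : P ∈ closedParamSet p q) :
    IntegrableOn (foxH A P.1 B P.2) (Set.Icc 0 (rho A B)) := by
  rw [integrableOn_Icc_iff_expPullback (rho_pos hAB)]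
  refine (((integrableOn_exp_neg_mul_sub_mainTerm hAB hP).add
    (integrableOn_exp_neg_mul_mainTerm (A := A) (B := B) hP.2)).const_mul (rho A B)).congr
    (Eventually.of_forall fun t => ?_)
  simp only [Pi.add_apply, expPullback, logFox]
  ring

lemma tendsto_mu_nhdsGT (hμ : mu P₀.1 P₀.2 = 0) :
    Tendsto (fun P : Param p q => mu P.1 P.2) (𝓝[paramSet p q] P₀) (𝓝[>] 0) :=
  tendsto_nhdsWithin_iff.mpr
    ⟨(hμ ▸ continuous_mu.tendsto P₀).mono_left nhdsWithin_le_nhds,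
      eventually_mem_nhdsWithin.mono fun _ hP => hP.2⟩

lemma tendsto_hankel_re (hμ : mu P₀.1 P₀.2 = 0) :
    Tendsto (fun P : Param p q => (hankel (mu P.1 P.2 + 1)).re) (𝓝[paramSet p q] P₀) (𝓝 1) :=
  ((continuous_re.tendsto 1).comp (tendsto_hankel_one_add.mono_left
    (nhdsWithin_mono 0 Set.Ioi_subset_Ici_self))).comp (tendsto_mu_nhdsGT hμ)

lemma tendsto_nu (hAB : IsDeltaNeutral A B) :
    Tendsto (fun P : Param p q => nu A P.1 B P.2) (𝓝[paramSet p q] P₀)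
      (𝓝 (nu A P₀.1 B P₀.2)) :=
  ((continuous_nu hAB).tendsto P₀).mono_left nhdsWithin_le_nhds

lemma tendsto_mainTerm (hAB : IsDeltaNeutral A B) (hμ : mu P₀.1 P₀.2 = 0) {t : ℝ} (ht : 0 < t) :
    Tendsto (fun P => mainTerm A B P t) (𝓝[paramSet p q] P₀) (𝓝 0) := by
  have hmu := (tendsto_mu_nhdsGT hμ).mono_right nhdsWithin_le_nhds
  have hpow := (Real.continuousAt_const_rpow ht.ne').tendsto.comp (hmu.sub_const 1)
  have hlim := ((tendsto_nu hAB).mul hpow).mul (hmu.mul (tendsto_hankel_re hμ))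
  rw [zero_mul, mul_zero] at hlim
  refine hlim.congr' ?_
  filter_upwards [self_mem_nhdsWithin] with P hP
  rw [mainTerm, hankel_re_eq_mul hP.2.le, Function.comp_apply]

lemma tendsto_logFox (hAB : IsDeltaNeutral A B) (hP₀ : P₀ ∈ closedParamSet p q) {t : ℝ}
    (ht : 0 < t) :
    Tendsto (fun P => logFox A B P t) (𝓝[paramSet p q] P₀) (𝓝 (logFox A B P₀ t)) := by
  have hcont := (continuousOn_logFox hAB).comp (s := closedParamSet p q)
    (f := fun P : Param p q => (P, t)) (by fun_prop) fun _ hP => ⟨hP, ht⟩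
  exact (hcont P₀ hP₀).tendsto.mono_left (nhdsWithin_mono _ paramSet_subset_closedParamSet)

variable {g : ℝ → ℝ} {D c : ℝ}

-- The atom arises here: `hankel μ ~ μ`, and `μ t ^ (μ - 1)` is an approximate identity at `t = 0`.
lemma tendsto_integral_mul_mainTerm (hAB : IsDeltaNeutral A B) (hμ : mu P₀.1 P₀.2 = 0)
    (hg : IntegrableOn g (Set.Ioi 0)) (hgc : Tendsto g (𝓝[>] 0) (𝓝 c)) :
    Tendsto (fun P => ∫ t in Set.Ioi 0, g t * mainTerm A B P t) (𝓝[paramSet p q] P₀)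
      (𝓝 (nu A P₀.1 B P₀.2 * c)) := by
  have hlim := ((tendsto_nu hAB).mul (tendsto_hankel_re hμ)).mul
    ((tendsto_integral_mul_rpow_sub_one hg hgc).comp (tendsto_mu_nhdsGT hμ))
  rw [mul_one] at hlim
  refine hlim.congr' ?_
  filter_upwards [self_mem_nhdsWithin] with P hP
  rw [Function.comp_apply, ← integral_const_mul]
  refine integral_congr_ae (Eventually.of_forall fun t => ?_)
  simp only [mainTerm, hankel_re_eq_mul hP.2.le]
  ring

lemma tendsto_integral_mul_sub_mainTerm (hAB : IsDeltaNeutral A B)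
    (hP₀ : P₀ ∈ closedParamSet p q) (hμ : mu P₀.1 P₀.2 = 0) (hg : Measurable g)
    (hgD : ∀ t, |g t| ≤ D * Real.exp (-t)) :
    Tendsto (fun P => ∫ t in Set.Ioi 0, g t * (logFox A B P t - mainTerm A B P t))
      (𝓝[paramSet p q] P₀) (𝓝 (∫ t in Set.Ioi 0, g t * logFox A B P₀ t)) := by
  obtain ⟨C, hC⟩ := exists_abs_logFox_sub_mainTerm_le hAB (M := ‖P₀‖ + 1) (by positivity)
  have hnear : ∀ᶠ P in 𝓝[paramSet p q] P₀, ‖P‖ < ‖P₀‖ + 1 :=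
    nhdsWithin_le_nhds (continuous_norm.continuousAt.eventually_lt_const (lt_add_one _))
  refine tendsto_integral_filter_of_dominated_convergence
    (fun t => D * C * Real.exp (-1 / 2 * t)) ?_ ?_
    ((integrableOn_exp_mul_Ioi (a := -1 / 2) (by norm_num) 0).const_mul (D * C)) ?_
  · filter_upwards [self_mem_nhdsWithin] with P hP
    exact hg.aestronglyMeasurable.mul
      (aestronglyMeasurable_logFox_sub_mainTerm hAB (paramSet_subset_closedParamSet hP))
  · filter_upwards [self_mem_nhdsWithin, hnear] with P hP hPn
    filter_upwards [ae_restrict_mem measurableSet_Ioi] with t ht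
    rw [norm_mul, ← exp_neg_mul_exp_half, mul_mul_mul_comm]
    exact mul_le_mul (hgD t) (hC P (paramSet_subset_closedParamSet hP) hPn.le t ht)
      (abs_nonneg _) ((abs_nonneg _).trans (hgD t))
  · filter_upwards [ae_restrict_mem measurableSet_Ioi] with t ht
    simpa using
      ((tendsto_logFox hAB hP₀ ht).sub (tendsto_mainTerm hAB hμ ht)).const_mul (g t)

lemma integrableOn_mul_of_abs_le_exp_neg {h : ℝ → ℝ} (hg : Measurable g)
    (hgD : ∀ t, |g t| ≤ D * Real.exp (-t))
    (hh : IntegrableOn (fun t => Real.exp (-t) * h t) (Set.Ioi 0)) :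
    IntegrableOn (fun t => g t * h t) (Set.Ioi 0) := by
  have hbdd : ∀ t, ‖g t * Real.exp t‖ ≤ D := fun t => by
    rw [norm_mul, Real.norm_of_nonneg (Real.exp_nonneg t), ← le_div_iff₀ (Real.exp_pos t),
      div_eq_mul_inv, ← Real.exp_neg]
    exact hgD t
  refine (hh.bdd_mul (hg.mul Real.measurable_exp).aestronglyMeasurable
    (Eventually.of_forall hbdd)).congr (Eventually.of_forall fun t => ?_)
  simp only [mul_assoc, Real.exp_neg, Pi.mul_apply]
  field_simp

lemma tendsto_integral_mul_logFox (hAB : IsDeltaNeutral A B) (hP₀ : P₀ ∈ closedParamSet p q)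
    (hμ : mu P₀.1 P₀.2 = 0) (hg : Measurable g) (hgD : ∀ t, |g t| ≤ D * Real.exp (-t))
    (hgc : Tendsto g (𝓝[>] 0) (𝓝 c)) :
    Tendsto (fun P => ∫ t in Set.Ioi 0, g t * logFox A B P t) (𝓝[paramSet p q] P₀)
      (𝓝 ((∫ t in Set.Ioi 0, g t * logFox A B P₀ t) + nu A P₀.1 B P₀.2 * c)) := by
  have hgi : IntegrableOn g (Set.Ioi 0) :=
    Integrable.mono' ((integrableOn_exp_neg_Ioi 0).const_mul D) hg.aestronglyMeasurable
      (Eventually.of_forall hgD)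
  refine ((tendsto_integral_mul_sub_mainTerm hAB hP₀ hμ hg hgD).add
    (tendsto_integral_mul_mainTerm hAB hμ hgi hgc)).congr' ?_
  filter_upwards [self_mem_nhdsWithin] with P hP
  have hP' := paramSet_subset_closedParamSet hP
  rw [← integral_add
    (integrableOn_mul_of_abs_le_exp_neg hg hgD (integrableOn_exp_neg_mul_sub_mainTerm hAB hP'))
    (integrableOn_mul_of_abs_le_exp_neg hg hgD (integrableOn_exp_neg_mul_mainTerm hP'.2))]
  simp only [← mul_add, sub_add_cancel]

theorem tendsto_setIntegral_mul_foxH (hAB : IsDeltaNeutral A B) (hP₀ : P₀ ∈ closedParamSet p q)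
    (hμ : mu P₀.1 P₀.2 = 0) {η : ℝ} (hη : 0 ≤ η) (hηρ : η < rho A B) {f : ℝ → ℝ}
    (hf : ContinuousOn f (Set.Icc η (rho A B))) :
    Tendsto (fun P : Param p q => ∫ x in Set.Icc η (rho A B), f x * foxH A P.1 B P.2 x)
      (𝓝[paramSet p q] P₀)
      (𝓝 ((∫ x in Set.Icc η (rho A B), f x * foxH A P₀.1 B P₀.2 x)
        + nu A P₀.1 B P₀.2 * (rho A B * f (rho A B)))) := by
  have hρ := rho_pos hAB
  obtain ⟨D, hD⟩ := exists_abs_expPullback_indicator_le hρ hf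
  simp only [setIntegral_mul_eq_expPullback hρ hη]
  exact tendsto_integral_mul_logFox hAB hP₀ hμ (measurable_expPullback_indicator hf) hD
    (tendsto_expPullback_indicator hρ hηρ hf)

end Limit

section SignedMeasure

variable {α : Type*} [MeasurableSpace α] {m : Measure α} {h f : α → ℝ}

lemma integrable_mul_max_zero (hh : AEStronglyMeasurable h m) (hf : AEStronglyMeasurable f m)
    (hfh : Integrable (fun x => f x * h x) m) : Integrable (fun x => f x * max (h x) 0) m := by
  refine hfh.mono (hf.mul (hh.sup aestronglyMeasurable_const)) (Eventually.of_forall fun x => ?_)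
  rw [norm_mul, norm_mul]
  gcongr
  rw [Real.norm_of_nonneg (le_max_right _ _)]
  exact max_le (le_abs_self _) (abs_nonneg _)

lemma integrable_withDensity_ofReal_iff (hh : AEMeasurable h m) :
    Integrable f (m.withDensity fun x => ENNReal.ofReal (h x))
      ↔ Integrable (fun x => f x * max (h x) 0) m := by
  rw [integrable_withDensity_iff_integrable_smul₀' hh.ennreal_ofReal (by simp)]
  simp only [ENNReal.toReal_ofReal', smul_eq_mul, mul_comm]

lemma integral_withDensity_ofReal (hh : AEMeasurable h m) (f : α → ℝ) :
    ∫ x, f x ∂(m.withDensity fun x => ENNReal.ofReal (h x)) = ∫ x, f x * max (h x) 0 ∂m := by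
  rw [integral_withDensity_eq_integral_toReal_smul₀ hh.ennreal_ofReal (by simp)]
  simp only [ENNReal.toReal_ofReal', smul_eq_mul, mul_comm]

lemma integrable_withDensityᵥ (hh : Integrable h m) (hf : AEStronglyMeasurable f m)
    (hfh : Integrable (fun x => f x * h x) m) : (m.withDensityᵥ h).Integrable f := by
  rw [VectorMeasure.Integrable, Measure.variation_withDensityᵥ hh]
  simp only [← ofReal_norm]
  rw [integrable_withDensity_ofReal_iff hh.1.norm.aemeasurable]
  exact hfh.mono (hf.mul (hh.1.norm.sup aestronglyMeasurable_const)) (by simp)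

lemma integral_withDensityᵥ (hh : Integrable h m) (hf : AEStronglyMeasurable f m)
    (hfh : Integrable (fun x => f x * h x) m) :
    ∫ᵛ x, f x ∂•(m.withDensityᵥ h) = ∫ x, f x * h x ∂m := by
  have hh_neg : Integrable (fun x => -h x) m := hh.neg
  have := isFiniteMeasure_withDensity_ofReal hh.2
  have := isFiniteMeasure_withDensity_ofReal hh_neg.2
  have hflip : ContinuousLinearMap.lsmul ℝ ℝ = (ContinuousLinearMap.lsmul ℝ ℝ (E := ℝ)).flip := by
    ext
    simp
  have hpos := integrable_mul_max_zero hh.1 hf hfh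
  have hneg := integrable_mul_max_zero hh_neg.1 hf (by simpa using hfh.neg)
  rw [withDensityᵥ_eq_withDensity_pos_part_sub_withDensity_neg_part hh,
    VectorMeasure.integral_sub_vectorMeasure, hflip, VectorMeasure.integral_toSignedMeasure,
    VectorMeasure.integral_toSignedMeasure]
  · calc ∫ x, f x ∂(m.withDensity fun x => ENNReal.ofReal (h x))
          - ∫ x, f x ∂(m.withDensity fun x => ENNReal.ofReal (-h x))
        = ∫ x, f x * max (h x) 0 - f x * max (-h x) 0 ∂m := by
          rw [integral_withDensity_ofReal hh.aemeasurable,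
            integral_withDensity_ofReal hh_neg.aemeasurable, integral_sub hpos hneg]
      _ = ∫ x, f x * h x ∂m := by
          simp only [← mul_sub, max_zero_sub_max_neg_zero_eq_self]
  · rwa [VectorMeasure.Integrable, Measure.variation_toSignedMeasure,
      integrable_withDensity_ofReal_iff hh.aemeasurable]
  · rwa [VectorMeasure.Integrable, Measure.variation_toSignedMeasure,
      integrable_withDensity_ofReal_iff hh_neg.aemeasurable]

lemma restrict_withDensityᵥ {E : Type*} [NormedAddCommGroup E] [NormedSpace ℝ E] {h : α → E}
    (hh : Integrable h m) {s : Set α} (hs : MeasurableSet s) :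
    (m.withDensityᵥ h).restrict s = (m.restrict s).withDensityᵥ h := by
  ext t ht
  rw [VectorMeasure.restrict_apply _ hs ht, withDensityᵥ_apply hh (ht.inter hs),
    withDensityᵥ_apply hh.integrableOn ht, Measure.restrict_restrict ht]

end SignedMeasure

section FoxMeasure

variable {p q : ℕ} {A a : Fin p → ℝ} {B b : Fin q → ℝ} {η : ℝ} {f : ℝ → ℝ}

lemma foxMeasure_restrict (hH : IntegrableOn (foxH A a B b) (Set.Icc 0 (rho A B))) (hη : 0 ≤ η) :
    (foxMeasure A a B b).restrict (Set.Icc η (rho A B))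
      = (volume.restrict (Set.Icc η (rho A B))).withDensityᵥ (foxH A a B b) := by
  rw [foxMeasure, restrict_withDensityᵥ hH measurableSet_Icc,
    Measure.restrict_restrict measurableSet_Icc,
    Set.inter_eq_self_of_subset_left (Set.Icc_subset_Icc_left hη)]

lemma integrableOn_foxMeasure (hH : IntegrableOn (foxH A a B b) (Set.Icc 0 (rho A B)))
    (hη : 0 ≤ η) (hf : ContinuousOn f (Set.Icc η (rho A B))) :
    (foxMeasure A a B b).IntegrableOn f (Set.Icc η (rho A B)) := by
  have hHη := hH.mono_set (Set.Icc_subset_Icc_left hη)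
  rw [VectorMeasure.IntegrableOn, foxMeasure_restrict hH hη]
  exact integrable_withDensityᵥ hHη (hf.aestronglyMeasurable measurableSet_Icc)
    (hHη.continuousOn_mul hf isCompact_Icc)

lemma setIntegral_foxMeasure (hH : IntegrableOn (foxH A a B b) (Set.Icc 0 (rho A B)))
    (hη : 0 ≤ η) (hf : ContinuousOn f (Set.Icc η (rho A B))) :
    ∫ᵛ x in Set.Icc η (rho A B), f x ∂•(foxMeasure A a B b)
      = ∫ x in Set.Icc η (rho A B), f x * foxH A a B b x := by
  have hHη := hH.mono_set (Set.Icc_subset_Icc_left hη)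
  rw [foxMeasure_restrict hH hη]
  exact integral_withDensityᵥ hHη (hf.aestronglyMeasurable measurableSet_Icc)
    (hHη.continuousOn_mul hf isCompact_Icc)

lemma setIntegral_limitMeasure (hH : IntegrableOn (foxH A a B b) (Set.Icc 0 (rho A B)))
    (hη : 0 ≤ η) (hηρ : η ≤ rho A B) (hf : ContinuousOn f (Set.Icc η (rho A B))) :
    ∫ᵛ x in Set.Icc η (rho A B), f x ∂•(limitMeasure A a B b)
      = (∫ x in Set.Icc η (rho A B), f x * foxH A a B b x)
        + nu A a B b * (rho A B * f (rho A B)) := by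
  rw [limitMeasure, VectorMeasure.restrict_add,
    VectorMeasure.restrict_dirac_of_mem measurableSet_Icc ⟨hηρ, le_rfl⟩,
    VectorMeasure.integral_add_vectorMeasure _ (integrableOn_foxMeasure hH hη hf),
    setIntegral_foxMeasure hH hη hf, VectorMeasure.integral_dirac]
  · simp only [ContinuousLinearMap.lsmul_apply, smul_eq_mul]
    ring
  · rw [VectorMeasure.Integrable, VectorMeasure.variation_dirac]
    exact (integrable_dirac (by simp)).smul_measure enorm_ne_top

end FoxMeasure

end FoxH

open FoxH in
theorem theorem3 {p q : ℕ} (A : Fin p → ℝ) (B : Fin q → ℝ)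
    (hA : ∀ k, 0 < A k) (hB : ∀ j, 0 < B j) (hΔ : Delta A B = 0)
    (aStar : Fin p → ℝ) (bStar : Fin q → ℝ)
    (ha : ∀ k, 0 ≤ aStar k) (hμ : mu aStar bStar = 0) :
    -- all the measures involved are finite signed measures on `[0, ρ]`
    (∀ P ∈ paramSet p q,
      MeasureTheory.IntegrableOn (foxH A P.1 B P.2) (Set.Icc 0 (rho A B))) ∧
    MeasureTheory.IntegrableOn (foxH A aStar B bStar) (Set.Icc 0 (rho A B)) ∧
    ∀ η : ℝ, 0 ≤ η → η < rho A B →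
      -- weak convergence on `[η, ρ]`
      WeakConvergesOn (fun P : (Fin p → ℝ) × (Fin q → ℝ) => foxMeasure A P.1 B P.2)
        (nhdsWithin (aStar, bStar) (paramSet p q)) (limitMeasure A aStar B bStar) η (rho A B) ∧
      -- the resulting regularization of the integrals of the zero-balanced function
      ∀ f : ℝ → ℝ, ContinuousOn f (Set.Icc η (rho A B)) →
        Filter.Tendsto
          (fun P : (Fin p → ℝ) × (Fin q → ℝ) =>
            (∫ x in Set.Icc η (rho A B), f x * foxH A P.1 B P.2 x)
              - nu A aStar B bStar * rho A B * f (rho A B))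
          (nhdsWithin (aStar, bStar) (paramSet p q))
          (nhds (∫ x in Set.Icc η (rho A B), f x * foxH A aStar B bStar x)) := by
  have hAB : IsDeltaNeutral A B := ⟨hA, hB, hΔ⟩
  have hP₀ : (aStar, bStar) ∈ closedParamSet p q := ⟨ha, hμ.ge⟩
  have hint : ∀ P ∈ paramSet p q, IntegrableOn (foxH A P.1 B P.2) (Set.Icc 0 (rho A B)) :=
    fun _ hP => integrableOn_foxH hAB (paramSet_subset_closedParamSet hP)
  have hint₀ := integrableOn_foxH hAB hP₀
  refine ⟨hint, hint₀, fun η hη hηρ => ⟨fun f hf => ?_, fun f hf => ?_⟩⟩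
  · rw [setIntegral_limitMeasure hint₀ hη hηρ.le hf]
    refine (tendsto_setIntegral_mul_foxH hAB hP₀ hμ hη hηρ hf).congr' ?_
    filter_upwards [self_mem_nhdsWithin] with P hP
    exact (setIntegral_foxMeasure (hint P hP) hη hf).symm
  · have hlim := (tendsto_setIntegral_mul_foxH hAB hP₀ hμ hη hηρ hf).sub_const
      (nu A aStar B bStar * rho A B * f (rho A B))
    rwa [← mul_assoc, add_sub_cancel_right] at hlim
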